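/- Let $(L_t)_{t\ge 0}$ be a real-valued Lévy process of finite variation with drift $\gamma\in\mathbb R$ and jump measure $\nu$, i.e. $\nu$ is a Borel measure on $\mathbb R$ with $\nu(\{0\})=0$, $\int(|x|\wedge 1)\,\nu(dx)<\infty$, and $\mathbb E[e^{iuL_t}]=\exp\big(t(i\gamma u+\int(e^{iux}-1)\,\nu(dx))\big)$. Fix $\Delta>0$, let $P_\nu$ be the law of $L_\Delta$ and $\varphi_\nu$ its characteristic function. Assume that $\nu(\mathbb R)=\infty$, that $\nu$ is absolutely continuous with respect to Lebesgue measure, and that for some $\beta,c>0$, $|\varphi_\nu(u)|\ge c(1+|u|)^{-\beta}$ for all $u\in\mathbb R$. All function spaces are real. Put $L^2_0(P_\nu)=\{g\in L^2(P_\nu):\int g\,dP_\nu=0\}$ and $\mathcal Ff(u)=\int e^{iux}f(x)\,dx$ (extended to $L^2(\mathbb R)$), let $H^s(\mathbb R)=\{f\in L^2(\mathbb R): (1+u^2)^{s/2}\mathcal Ff(u)\in L^2(\mathbb R)\}$ and $H^\infty(\mathbb R)=\bigcap_{s\ge0}H^s(\mathbb R)$. Define $$\mathcal G=\{g\in H^\infty(\mathbb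 R): g\in L^2_0(P_\nu)\},\qquad \mathcal H=\{b\in H^\infty(\mathbb R): b(0)=0\}\cap L^1(\nu)\cap L^2(\nu),$$ as sets of Lebesgue-a.e. equivalence classes, where $b(0)$ is the value at $0$ of the continuous version of $b$. Each $g\in\mathcal G$ defines an element of $L^2_0(P_\nu)$ and each $b\in\mathcal H$ an element of $L^2(\nu)$. The score operator $A_\nu$ is the bounded linear operator into $L^2_0(P_\nu)$, defined on $L^1(\nu)\cap L^2(\nu)$ with the $L^2(\nu)$-norm and extended continuously to its closure $L^2(\nu)$, such that for every $b\in L^1(\nu)\cap L^2(\nu)\cap L^\infty(\nu)$ the function $A_\nu b$ is the $P_\nu$-density of the finite signed measure $\Delta\big(P_\nu*(b\nu)-(\int b\,d\nu)P_\nu\big)$. It exists and is unique. Let $A_\nu^\star:L^2_0(P_\nu)\to L^2(\nu)$ be its adjoint. Then: 1. The map $g\mapsto\Delta\,(P_\nu(-\cdot)*g)$, where $(P_\nu(-\cdot)*g)(x)=\int g(x+y)\,P_\nu(dy)$ (the integral exists for a.e. $x$), is a bijection from $\mathcal G$ onto $\mathcal H$, and for $g\in\mathcal G$ it gives $A_\nu^\star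 g$ ($\nu$-almost everywhere). Its inverse is $b\mapsto\Delta^{-1}\mathcal F^{-1}\big[\mathcal Fb/\varphi_\nu(-\cdot)\big]$, where $\mathcal Fb/\varphi_\nu(-\cdot)$ is integrable and $\mathcal F^{-1}h(x)=\frac1{2\pi}\int e^{-iux}h(u)\,du$. 2. (The image of) $\mathcal G$ is dense in $L^2_0(P_\nu)$, and $A_\nu^\star$ is the unique continuous map $L^2_0(P_\nu)\to L^2(\nu)$ that sends every $g\in\mathcal G$ to the class of $\Delta\,(P_\nu(-\cdot)*g)$ in $L^2(\nu)$. -/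

import Mathlib

open MeasureTheory ProbabilityTheory Filter Topology
open scoped NNReal ENNReal

noncomputable section

namespace LevyScore

/-! ### Finite variation Lévy processes -/

/-- A real-valued Lévy process: it starts in zero almost surely, has independent and stationary
increments, and is stochastically continuous. -/
structure IsLevyProcess {Ω : Type*} [MeasurableSpace Ω] (μ : Measure Ω)
    (L : ℝ≥0 → Ω → ℝ) : Prop where
  measurable : ∀ t, Measurable (L t)
  zero : ∀ᵐ ω ∂μ, L 0 ω = 0
  indep : HasIndepIncrements L μ
  stationary : ∀ s t, IdentDistrib (fun ω => L (s + t) ω - L s ω) (L t) μ μ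
  stochContinuous : ∀ t, TendstoInMeasure μ L (𝓝 t) (L t)

/-- Jump measures `ν` with `∫ (|x| ∧ 1) dν < ∞` and `ν {0} = 0`. -/
structure IsFiniteVariationJumpMeasure (ν : Measure ℝ) : Prop where
  singleton_zero : ν {0} = 0
  lintegral_lt_top : ∫⁻ x, ENNReal.ofReal (min |x| 1) ∂ν < ∞

/-- The function `u ↦ exp (t (iγu + ∫ (e^{iux} - 1) ν(dx)))`. -/
def levyCharFun (t γ : ℝ) (ν : Measure ℝ) (u : ℝ) : ℂ :=
  Complex.exp (t * (Complex.I * γ * u + ∫ x, (Complex.exp (Complex.I * u * x) - 1) ∂ν))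

/-- `L` is a finite variation Lévy process with drift `γ` and jump measure `ν`
(no Gaussian part). -/
structure IsFiniteVariationLevyProcess {Ω : Type*} [MeasurableSpace Ω] (μ : Measure Ω)
    (L : ℝ≥0 → Ω → ℝ) (γ : ℝ) (ν : Measure ℝ) : Prop where
  isLevy : IsLevyProcess μ L
  jumpMeasure : IsFiniteVariationJumpMeasure ν
  charFun_eq : ∀ (t : ℝ≥0) (u : ℝ), charFun (μ.map (L t)) u = levyCharFun t γ ν u

/-! ### Fourier transform and Sobolev spaces, with `F f (u) = ∫ e^{iux} f(x) dx` -/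

/-- `F f` for `f ∈ L²(ℝ)` real-valued, normalized as `F f (u) = ∫ e^{iux} f(x) dx`. Mathlib's
transform is the extension of `v ↦ ∫ e^{-2πixv} f(x) dx` to `L²`, whence the change of variable. -/
def fourierL2 (f : Lp ℝ 2 (volume : Measure ℝ)) (u : ℝ) : ℂ :=
  (Lp.fourierTransformₗᵢ ℝ ℂ (Complex.ofRealCLM.compLp f) : Lp ℂ 2 (volume : Measure ℝ))
    (-(u / (2 * Real.pi)))

/-- `F⁻¹ h (x) = (2π)⁻¹ ∫ e^{-iux} h(u) du` for integrable `h`. -/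
def fourierInv (h : ℝ → ℂ) (x : ℝ) : ℂ :=
  (2 * Real.pi : ℂ)⁻¹ * ∫ u : ℝ, Complex.exp (-(Complex.I * u * x)) * h u

/-- `f ∈ H^s(ℝ)`: the function `(1 + u²)^{s/2} F f (u)` is square integrable. -/
def MemSobolev (s : ℝ) (f : Lp ℝ 2 (volume : Measure ℝ)) : Prop :=
  MemLp (fun u : ℝ => (((1 + u ^ 2) ^ (s / 2) : ℝ) : ℂ) * fourierL2 f u) 2 volume

/-- `H^∞(ℝ) = ⋂_{s ≥ 0} H^s(ℝ)`, a set of Lebesgue classes. -/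
def sobolevInfty : Set (Lp ℝ 2 (volume : Measure ℝ)) :=
  {f | ∀ s : ℝ, 0 ≤ s → MemSobolev s f}

/-! ### The space `L²₀(P)` -/

/-- `L²₀(P) = {g ∈ L²(P) | ∫ g dP = 0}`. -/
def L20 (P : Measure ℝ) [IsProbabilityMeasure P] : Submodule ℝ (Lp ℝ 2 P) where
  carrier := {g | ∫ x, g x ∂P = 0}
  zero_mem' := by
    simpa only [Set.mem_ofPred_eq, integral_zero] using
      (integral_congr_ae (Lp.coeFn_zero ..) : ∫ x, (0 : Lp ℝ 2 P) x ∂P = ∫ _x, (0 : ℝ) ∂P)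
  add_mem' := by
    intro f g hf hg
    have hf' : Integrable f P := (Lp.memLp f).integrable (by norm_num)
    have hg' : Integrable g P := (Lp.memLp g).integrable (by norm_num)
    have h : ∫ x, (f + g) x ∂P = ∫ x, (f x + g x) ∂P := integral_congr_ae (Lp.coeFn_add f g)
    simp only [Set.mem_ofPred_eq] at hf hg ⊢
    rw [h, integral_add hf' hg', hf, hg, add_zero]
  smul_mem' := by
    intro c f hf
    have h : ∫ x, (c • f) x ∂P = ∫ x, c * f x ∂P := integral_congr_ae (Lp.coeFn_smul c f)
    simp only [Set.mem_ofPred_eq] at hf ⊢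
    rw [h, integral_const_mul, hf, mul_zero]

theorem isClosed_L20 (P : Measure ℝ) [IsProbabilityMeasure P] :
    IsClosed (L20 P : Set (Lp ℝ 2 P)) := by
  have key : (L20 P : Set (Lp ℝ 2 P)) =
      {g | inner ℝ (indicatorConstLp 2 MeasurableSet.univ (measure_ne_top P _) (1 : ℝ)) g = 0} := by
    ext g
    have h := L2.inner_indicatorConstLp_one (𝕜 := ℝ) (μ := P) MeasurableSet.univ
      (measure_ne_top P _) g
    simp only [Set.mem_ofPred_eq, h, Measure.restrict_univ]
    rfl
  rw [key]
  exact isClosed_eq (by fun_prop) continuous_const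

instance (P : Measure ℝ) [IsProbabilityMeasure P] : CompleteSpace (L20 P) :=
  (isClosed_L20 P).completeSpace_coe

/-! ### The score operator -/

/-- `A` is the score operator at `ν`: the bounded operator `L²(ν) → L²₀(P)` such that for every
`b ∈ L¹(ν) ∩ L²(ν) ∩ L^∞(ν)` the function `A b` is the `P`-density of the signed measure
`Δ (P ∗ (bν) - (∫ b dν) P)`. As `L¹(ν) ∩ L²(ν)` is dense in `L²(ν)`, the operator on
`L¹(ν) ∩ L²(ν)` is identified with its continuous extension to `L²(ν)`. -/
def IsScoreOperator (Δ : ℝ) (ν P : Measure ℝ) [IsProbabilityMeasure P]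
    (A : Lp ℝ 2 ν →L[ℝ] L20 P) : Prop :=
  ∀ b : Lp ℝ 2 ν, MemLp b 1 ν → MemLp b ∞ ν → ∀ E : Set ℝ, MeasurableSet E →
    ∫ y in E, (A b : Lp ℝ 2 P) y ∂P =
      Δ * ((∫ x, b x * P.real {y | x + y ∈ E} ∂ν) - (∫ x, b x ∂ν) * P.real E)

/-! ### The sets `G` and `H` and the convolution -/

/-- `G = H^∞(ℝ) ∩ L²₀(P)`. -/
def setG (P : Measure ℝ) : Set (Lp ℝ 2 (volume : Measure ℝ)) :=
  {g | g ∈ sobolevInfty ∧ MemLp g 2 P ∧ ∫ x, g x ∂P = 0}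

/-- `H = {b ∈ H^∞(ℝ) | b(0) = 0} ∩ L¹(ν) ∩ L²(ν)`, where `b(0)` is the value of the continuous
version of `b`. -/
def setH (ν : Measure ℝ) : Set (Lp ℝ 2 (volume : Measure ℝ)) :=
  {b | b ∈ sobolevInfty ∧ (∃ c : ℝ → ℝ, Continuous c ∧ b =ᵐ[volume] c ∧ c 0 = 0) ∧
    MemLp b 1 ν ∧ MemLp b 2 ν}

/-- The element of `L²₀(P)` given by `g ∈ G`. -/
def toL20 {P : Measure ℝ} [IsProbabilityMeasure P] (g : setG P) : L20 P :=
  ⟨g.2.2.1.toLp, (integral_congr_ae g.2.2.1.coeFn_toLp).trans g.2.2.2⟩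

/-- `(P(-·) ∗ g)(x) = ∫ g(x + y) P(dy)`. -/
def reflConv (P : Measure ℝ) (g : ℝ → ℝ) (x : ℝ) : ℝ := ∫ y, g (x + y) ∂P

end LevyScore

end

noncomputable section

namespace LevyScore

/-! ### Characters -/

/-! Everything is read off on characters `e_u(x) = exp(iux)`. The Lévy–Khintchine formula gives
`φ(t-s) = conj φ(s) · φ(t) · exp(Δ ⟨e_s - 1, e_t - 1⟩)`, with the inner product of `L²(ν)`; the left
side is the Gram kernel of the characters in `L²(P)`. Expanding the exponential gives positive
semidefinite kernels (Schur products), and keeping only the linear term yields the Poincaré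
inequality `norm_sq_score_le`. So `e_u ↦ φ(u)(e_u - 1)` extends to a bounded map `L²(P) → L²(ν)`.
The real part of `Δ` times its adjoint, taken on real functions, has the transform prescribed for
the score, and uniqueness of Fourier transforms makes it the score operator
(`HasScoreTransform.isScoreOperator`).

Boundedness of the score operator forces `P ≪ volume`: on a Lebesgue-null set charged by `P`,
indicators of sets of large `ν`-mass would violate Cauchy–Schwarz
(`IsScoreOperator.absolutelyContinuous`).

The convolution is the Fourier multiplier `Δ φ(-u)`. It is bounded and its inverse grows
polynomially, so both act on `H^∞`. The image has value `Δ ∫ g dP` at `0`, so mean zero corresponds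
to vanishing at `0` (`exists_equiv`). Testing against indicators identifies the convolution with the
adjoint (`adjoint_toL20_ae_eq`), and smooth compactly supported functions give density
(`denseRange_toL20`). -/

theorem norm_exp_I_mul (u x : ℝ) : ‖Complex.exp (Complex.I * u * x)‖ = 1 := by
  rw [show Complex.I * u * x = ((u * x : ℝ) : ℂ) * Complex.I by push_cast; ring]
  exact Complex.norm_exp_ofReal_mul_I _

theorem conj_exp_I_mul (u x : ℝ) :
    (starRingEnd ℂ) (Complex.exp (Complex.I * u * x)) = Complex.exp (Complex.I * (-u : ℝ) * x) := by
  rw [← Complex.exp_conj]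
  simp

theorem exp_I_mul_add (u x y : ℝ) : Complex.exp (Complex.I * u * (x + y : ℝ)) =
    Complex.exp (Complex.I * u * x) * Complex.exp (Complex.I * u * y) := by
  rw [← Complex.exp_add]
  congr 1
  push_cast
  ring

theorem charFun_eq_integral_exp (P : Measure ℝ) (u : ℝ) :
    charFun P u = ∫ x, Complex.exp (Complex.I * u * x) ∂P := by
  rw [charFun_apply_real]
  congr 1 with x
  congr 1
  ring

/-- One bound for small and large `x`. It gives integrability against `ν`, and later the Lipschitz
estimate for `H^∞` functions at `0`. -/
theorem norm_exp_I_mul_sub_one_le (u x : ℝ) :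
    ‖Complex.exp (Complex.I * u * x) - 1‖ ≤ (2 + |u|) * min |x| 1 := by
  have h1 : ‖Complex.exp (Complex.I * u * x) - 1‖ ≤ |u| * |x| := by
    have := Real.norm_exp_I_mul_ofReal_sub_one_le (x := u * x)
    rw [Real.norm_eq_abs, abs_mul] at this
    convert this using 4
    push_cast
    ring
  have h2 : ‖Complex.exp (Complex.I * u * x) - 1‖ ≤ 2 := by
    refine (norm_sub_le _ _).trans ?_
    rw [norm_exp_I_mul, norm_one]
    norm_num
  have hu := abs_nonneg u
  have hx := abs_nonneg x
  rcases le_total |x| 1 with h | h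
  · rw [min_eq_left h]
    nlinarith
  · rw [min_eq_right h]
    linarith

/-- The image of `f⁺ μ` under `X`. -/
def posPush {Ω : Type*} [MeasurableSpace Ω] (μ : Measure Ω) (X : Ω → ℝ) (f : Ω → ℝ) : Measure ℝ :=
  (μ.withDensity fun ω => ENNReal.ofReal (f ω)).map X

section posPush

variable {Ω : Type*} [MeasurableSpace Ω] {μ : Measure Ω} {X : Ω → ℝ} {f : Ω → ℝ}

theorem isFiniteMeasure_posPush (hf : Integrable f μ) : IsFiniteMeasure (posPush μ X f) := by
  have := isFiniteMeasure_withDensity_ofReal hf.2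
  unfold posPush
  infer_instance

theorem integral_posPush (hX : Measurable X) (hf : Integrable f μ) {g : ℝ → ℂ} (hg : Continuous g) :
    ∫ x, g x ∂(posPush μ X f) = ∫ ω, ((max (f ω) 0 : ℝ) : ℂ) * g (X ω) ∂μ := by
  unfold posPush
  rw [integral_map hX.aemeasurable hg.aestronglyMeasurable,
    integral_withDensity_eq_integral_toReal_smul₀ hf.aemeasurable.ennreal_ofReal (by simp)]
  simp only [ENNReal.toReal_ofReal', Complex.real_smul]

theorem real_posPush (hX : Measurable X) (hf : Integrable f μ) {E : Set ℝ} (hE : MeasurableSet E) :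
    (posPush μ X f).real E = ∫ ω in X ⁻¹' E, max (f ω) 0 ∂μ := by
  unfold posPush
  rw [measureReal_def, Measure.map_apply hX hE, withDensity_apply _ (hX hE),
    integral_eq_lintegral_of_nonneg_ae (by filter_upwards with ω; exact le_max_right _ _)
      (hf.pos_part.aestronglyMeasurable.restrict)]
  congr 2 with ω
  simp

theorem max_zero_sub_max_neg_zero (r : ℝ) : max r 0 - max (-r) 0 = r := by
  rcases le_total r 0 with h | h
  · rw [max_eq_right h, max_eq_left (by linarith)]; ring
  · rw [max_eq_left h, max_eq_right (by linarith)]; ring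

theorem integral_exp_posPush_sub (hX : Measurable X) (hf : Integrable f μ) (u : ℝ) :
    ∫ x, Complex.exp (Complex.I * u * x) ∂(posPush μ X f) -
        ∫ x, Complex.exp (Complex.I * u * x) ∂(posPush μ X (-f)) =
      ∫ ω, (f ω : ℂ) * Complex.exp (Complex.I * u * X ω) ∂μ := by
  have hcont : Continuous fun x : ℝ => Complex.exp (Complex.I * u * x) := by fun_prop
  have hint : ∀ {f : Ω → ℝ}, Integrable f μ →
      Integrable (fun ω => ((max (f ω) 0 : ℝ) : ℂ) * Complex.exp (Complex.I * u * X ω)) μ :=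
    fun hf => hf.pos_part.ofReal.mul_bdd (c := 1)
      (hcont.measurable.comp hX).aestronglyMeasurable
      (by filter_upwards with x; exact (norm_exp_I_mul _ _).le)
  rw [integral_posPush hX hf hcont, integral_posPush hX hf.neg hcont,
    ← integral_sub (hint hf) (hint hf.neg)]
  congr 1 with ω
  rw [← sub_mul, ← Complex.ofReal_sub, Pi.neg_apply, max_zero_sub_max_neg_zero]

theorem real_posPush_sub (hX : Measurable X) (hf : Integrable f μ) {E : Set ℝ}
    (hE : MeasurableSet E) :
    (posPush μ X f).real E - (posPush μ X (-f)).real E = ∫ ω in X ⁻¹' E, f ω ∂μ := by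
  rw [real_posPush hX hf hE, real_posPush hX hf.neg hE,
    ← integral_sub hf.pos_part.restrict hf.neg.pos_part.restrict]
  congr 1 with ω
  exact max_zero_sub_max_neg_zero _

end posPush

/-- Real densities whose images have the same Fourier transform have the same image. -/
theorem setIntegral_preimage_eq_of_char {Ω₁ Ω₂ : Type*} [MeasurableSpace Ω₁] [MeasurableSpace Ω₂]
    {μ₁ : Measure Ω₁} {μ₂ : Measure Ω₂} {X₁ : Ω₁ → ℝ} {X₂ : Ω₂ → ℝ} (hX₁ : Measurable X₁)
    (hX₂ : Measurable X₂) {f₁ : Ω₁ → ℝ} {f₂ : Ω₂ → ℝ} (hf₁ : Integrable f₁ μ₁)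
    (hf₂ : Integrable f₂ μ₂)
    (h : ∀ u : ℝ, ∫ ω, (f₁ ω : ℂ) * Complex.exp (Complex.I * u * X₁ ω) ∂μ₁ =
      ∫ ω, (f₂ ω : ℂ) * Complex.exp (Complex.I * u * X₂ ω) ∂μ₂)
    {E : Set ℝ} (hE : MeasurableSet E) :
    ∫ ω in X₁ ⁻¹' E, f₁ ω ∂μ₁ = ∫ ω in X₂ ⁻¹' E, f₂ ω ∂μ₂ := by
  have := isFiniteMeasure_posPush (X := X₁) hf₁
  have := isFiniteMeasure_posPush (X := X₁) hf₁.neg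
  have := isFiniteMeasure_posPush (X := X₂) hf₂
  have := isFiniteMeasure_posPush (X := X₂) hf₂.neg
  -- Negative parts are moved across, so that injectivity of the characteristic function is needed
  -- only for finite positive measures.
  have key : posPush μ₁ X₁ f₁ + posPush μ₂ X₂ (-f₂) = posPush μ₁ X₁ (-f₁) + posPush μ₂ X₂ f₂ := by
    refine Measure.ext_of_charFun (funext fun u => ?_)
    have hcont : Continuous fun x : ℝ => Complex.exp (Complex.I * u * x) := by fun_prop
    have hint : ∀ (ρ : Measure ℝ) [IsFiniteMeasure ρ],
        Integrable (fun x : ℝ => Complex.exp (Complex.I * u * x)) ρ := fun ρ _ =>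
      (integrable_const (1 : ℝ)).mono' hcont.aestronglyMeasurable
        (by filter_upwards with x; rw [norm_exp_I_mul])
    simp only [charFun_eq_integral_exp]
    rw [integral_add_measure (hint _) (hint _), integral_add_measure (hint _) (hint _)]
    linear_combination integral_exp_posPush_sub hX₁ hf₁ u - integral_exp_posPush_sub hX₂ hf₂ u + h u
  have hE' : (posPush μ₁ X₁ f₁ + posPush μ₂ X₂ (-f₂)).real E =
      (posPush μ₁ X₁ (-f₁) + posPush μ₂ X₂ f₂).real E := by rw [key]
  rw [measureReal_add_apply, measureReal_add_apply] at hE'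
  linarith [real_posPush_sub hX₁ hf₁ hE, real_posPush_sub hX₂ hf₂ hE]

theorem integrable_mul_exp_I_mul {P : Measure ℝ} {f : ℝ → ℂ} (hf : Integrable f P) (u : ℝ) :
    Integrable (fun x => f x * Complex.exp (Complex.I * u * x)) P :=
  hf.mul_bdd (c := 1) (Continuous.aestronglyMeasurable (by fun_prop))
    (by filter_upwards with x; exact (norm_exp_I_mul _ _).le)

theorem ae_eq_zero_of_char_real {P : Measure ℝ} {f : ℝ → ℝ} (hf : Integrable f P)
    (h : ∀ u : ℝ, ∫ x, (f x : ℂ) * Complex.exp (Complex.I * u * x) ∂P = 0) : f =ᵐ[P] 0 := by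
  refine hf.ae_eq_zero_of_forall_setIntegral_eq_zero fun E hE _ => ?_
  have := setIntegral_preimage_eq_of_char (X₁ := id) (X₂ := id) measurable_id measurable_id hf
    (integrable_zero ℝ ℝ P) (fun u => by simpa using! h u) hE
  simpa using this

theorem integral_conj_mul_exp {P : Measure ℝ} (f : ℝ → ℂ) (u : ℝ) :
    ∫ x, (starRingEnd ℂ) (f x) * Complex.exp (Complex.I * u * x) ∂P =
      (starRingEnd ℂ) (∫ x, f x * Complex.exp (Complex.I * (-u : ℝ) * x) ∂P) := by
  rw [← integral_conj]
  congr 1 with x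
  rw [map_mul, conj_exp_I_mul, neg_neg]

/-- Conjugating `f` conjugates the transform and reflects its argument. This lets complex results
descend to real functions. -/
theorem integral_re_mul_exp {P : Measure ℝ} {f : ℝ → ℂ} (hf : Integrable f P) (u : ℝ) :
    ∫ x, ((f x).re : ℂ) * Complex.exp (Complex.I * u * x) ∂P =
      (∫ x, f x * Complex.exp (Complex.I * u * x) ∂P +
        (starRingEnd ℂ) (∫ x, f x * Complex.exp (Complex.I * (-u : ℝ) * x) ∂P)) / 2 := by
  have hc : Integrable (fun x => (starRingEnd ℂ) (f x)) P :=
    (Complex.conjCLE : ℂ →L[ℝ] ℂ).integrable_comp hf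
  rw [← integral_conj_mul_exp, ← integral_add (integrable_mul_exp_I_mul hf u)
    (integrable_mul_exp_I_mul hc u), ← integral_div]
  congr 1 with x
  rw [Complex.re_eq_add_conj]
  ring

theorem ae_eq_zero_of_char {P : Measure ℝ} {f : ℝ → ℂ} (hf : Integrable f P)
    (h : ∀ u : ℝ, ∫ x, f x * Complex.exp (Complex.I * u * x) ∂P = 0) : f =ᵐ[P] 0 := by
  have hre : ∀ g : ℝ → ℂ, Integrable g P →
      (∀ u : ℝ, ∫ x, g x * Complex.exp (Complex.I * u * x) ∂P = 0) →
      (fun x => (g x).re) =ᵐ[P] 0 := fun g hg hz =>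
    ae_eq_zero_of_char_real hg.re fun u => by
      have := integral_re_mul_exp hg u
      rw [hz, hz] at this
      simpa using this
  have h1 := hre f hf h
  -- The imaginary part of `f` is the real part of `-i f`.
  have h2 := hre (fun x => -Complex.I * f x) (hf.const_mul _) fun u => by
    simp only [mul_assoc]
    rw [integral_const_mul]
    simp only [← mul_assoc, h, mul_zero]
  filter_upwards [h1, h2] with x hx1 hx2
  apply Complex.ext
  · simpa using hx1
  · simpa using hx2

/-! ### Construction of the score operator -/

/-! ### Integrability against the jump measure -/

section jump

variable {ν : Measure ℝ}

theorem IsFiniteVariationJumpMeasure.integrable_min (hν : IsFiniteVariationJumpMeasure ν) :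
    Integrable (fun x => min |x| 1) ν := by
  refine ⟨Continuous.aestronglyMeasurable (by fun_prop), ?_⟩
  rw [hasFiniteIntegral_iff_ofReal (by filter_upwards with x; positivity)]
  exact hν.lintegral_lt_top

theorem IsFiniteVariationJumpMeasure.integrable_of_le (hν : IsFiniteVariationJumpMeasure ν)
    {E : Type*} [NormedAddCommGroup E] {f : ℝ → E} (hf : AEStronglyMeasurable f ν) {C : ℝ}
    (hC : ∀ x, ‖f x‖ ≤ C * min |x| 1) : Integrable f ν :=
  (hν.integrable_min.const_mul C).mono' hf (by filter_upwards with x; exact hC x)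

theorem IsFiniteVariationJumpMeasure.memLp_two_of_le (hν : IsFiniteVariationJumpMeasure ν)
    {E : Type*} [NormedAddCommGroup E] {f : ℝ → E} (hf : AEStronglyMeasurable f ν) {C : ℝ}
    (hC : ∀ x, ‖f x‖ ≤ C * min |x| 1) : MemLp f 2 ν := by
  rw [memLp_two_iff_integrable_sq_norm hf]
  refine hν.integrable_of_le (C := C ^ 2) (hf.norm.pow 2) fun x => ?_
  have h0 : 0 ≤ min |x| 1 := le_min (abs_nonneg x) zero_le_one
  have h1 : min |x| 1 ≤ 1 := min_le_right _ _
  rw [norm_pow, norm_norm]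
  calc ‖f x‖ ^ 2 ≤ (C * min |x| 1) ^ 2 := by gcongr; exact hC x
    _ = C ^ 2 * (min |x| 1 * min |x| 1) := by ring
    _ ≤ C ^ 2 * (min |x| 1 * 1) := by gcongr
    _ = C ^ 2 * min |x| 1 := by ring

theorem IsFiniteVariationJumpMeasure.integrable_exp_sub_one
    (hν : IsFiniteVariationJumpMeasure ν) (u : ℝ) :
    Integrable (fun x : ℝ => Complex.exp (Complex.I * u * x) - 1) ν :=
  hν.integrable_of_le (Continuous.aestronglyMeasurable (by fun_prop)) (norm_exp_I_mul_sub_one_le u)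

theorem IsFiniteVariationJumpMeasure.memLp_exp_sub_one
    (hν : IsFiniteVariationJumpMeasure ν) (u : ℝ) :
    MemLp (fun x : ℝ => Complex.exp (Complex.I * u * x) - 1) 2 ν :=
  hν.memLp_two_of_le (Continuous.aestronglyMeasurable (by fun_prop)) (norm_exp_I_mul_sub_one_le u)

theorem IsFiniteVariationJumpMeasure.measure_ge_lt_top (hν : IsFiniteVariationJumpMeasure ν)
    {ε : ℝ} (hε : 0 < ε) : ν {x | ε ≤ |x|} < ∞ := by
  have h := hν.integrable_min.measure_norm_ge_lt_top (lt_min hε zero_lt_one)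
  refine (measure_mono fun x hx => ?_).trans_lt h
  have hx' : ε ≤ |x| := hx
  simp only [Set.mem_ofPred_eq, Real.norm_eq_abs]
  rw [abs_of_nonneg (by positivity)]
  exact min_le_min_right 1 hx'

theorem IsFiniteVariationJumpMeasure.iUnion_ge :
    ⋃ n : ℕ, {x : ℝ | 1 / ((n : ℝ) + 1) ≤ |x|} = {0}ᶜ := by
  ext x
  simp only [Set.mem_iUnion, Set.mem_ofPred_eq, Set.mem_compl_iff, Set.mem_singleton_iff]
  constructor
  · rintro ⟨n, hn⟩ rfl
    rw [abs_zero] at hn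
    exact absurd hn (not_le.mpr (by positivity))
  · intro hx
    obtain ⟨n, hn⟩ := exists_nat_one_div_lt (abs_pos.mpr hx)
    exact ⟨n, hn.le⟩

/-- Markov's inequality makes the mass away from `0` finite, and `0` itself is null. The Fubini
arguments need this, since `ν` may be infinite. -/
theorem IsFiniteVariationJumpMeasure.sigmaFinite (hν : IsFiniteVariationJumpMeasure ν) :
    SigmaFinite ν :=
  ⟨⟨{ set := fun n => {0} ∪ {x | 1 / ((n : ℝ) + 1) ≤ |x|}
      set_mem := fun _ => trivial
      finite := fun n => measure_union_lt_top (by simp [hν.singleton_zero])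
        (hν.measure_ge_lt_top (by positivity))
      spanning := by
        rw [← Set.union_iUnion, IsFiniteVariationJumpMeasure.iUnion_ge, Set.union_compl_self] }⟩⟩

end jump

/-! ### Positive definite kernels and the Poincaré inequality -/

section construction

variable {ν P : Measure ℝ} [IsProbabilityMeasure P] {Δ γ : ℝ}

theorem memLp_exp_I_mul (P : Measure ℝ) [IsProbabilityMeasure P] (u : ℝ) :
    MemLp (fun x : ℝ => Complex.exp (Complex.I * u * x)) 2 P :=
  MemLp.of_bound (Continuous.aestronglyMeasurable (by fun_prop)) 1
    (by filter_upwards with x; exact (norm_exp_I_mul _ _).le)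

/-- The character `x ↦ exp (iux)` in `L²(P)`. -/
def expLp (P : Measure ℝ) [IsProbabilityMeasure P] (u : ℝ) : Lp ℂ 2 P := (memLp_exp_I_mul P u).toLp

/-- The function `x ↦ exp (iux) - 1` in `L²(ν)`. -/
def expSubOneLp (hν : IsFiniteVariationJumpMeasure ν) (u : ℝ) : Lp ℂ 2 ν :=
  (hν.memLp_exp_sub_one u).toLp

theorem inner_expLp_left (u : ℝ) (f : Lp ℂ 2 P) :
    inner ℂ (expLp P u) f = ∫ x, f x * Complex.exp (Complex.I * (-u : ℝ) * x) ∂P := by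
  rw [L2.inner_def]
  refine integral_congr_ae ?_
  filter_upwards [(memLp_exp_I_mul P u).coeFn_toLp] with x hx
  simp only [expLp, hx, RCLike.inner_apply, conj_exp_I_mul]

theorem inner_expSubOneLp_left (hν : IsFiniteVariationJumpMeasure ν) (u : ℝ) (f : Lp ℂ 2 ν) :
    inner ℂ (expSubOneLp hν u) f =
      ∫ x, f x * (Complex.exp (Complex.I * (-u : ℝ) * x) - 1) ∂ν := by
  rw [L2.inner_def]
  refine integral_congr_ae ?_
  filter_upwards [(hν.memLp_exp_sub_one u).coeFn_toLp] with x hx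
  simp only [expSubOneLp, hx, RCLike.inner_apply, map_sub, conj_exp_I_mul, map_one]

theorem exp_I_mul_mul_exp (s t x : ℝ) :
    Complex.exp (Complex.I * t * x) * Complex.exp (Complex.I * (-s : ℝ) * x) =
      Complex.exp (Complex.I * (t - s : ℝ) * x) := by
  rw [← Complex.exp_add]
  congr 1
  push_cast
  ring

theorem inner_expLp (s t : ℝ) : inner ℂ (expLp P s) (expLp P t) = charFun P (t - s) := by
  rw [inner_expLp_left, charFun_eq_integral_exp]
  refine integral_congr_ae ?_
  filter_upwards [(memLp_exp_I_mul P t).coeFn_toLp] with x hx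
  simp only [expLp, hx, exp_I_mul_mul_exp]

/-- Integrates `(e_t - 1)(e_{-s} - 1) = (e_{t-s} - 1) - (e_t - 1) - (e_{-s} - 1)`. -/
theorem inner_expSubOneLp (hν : IsFiniteVariationJumpMeasure ν) (s t : ℝ) :
    inner ℂ (expSubOneLp hν s) (expSubOneLp hν t) =
      ∫ x : ℝ, (Complex.exp (Complex.I * (t - s : ℝ) * x) - 1) ∂ν
        - ∫ x : ℝ, (Complex.exp (Complex.I * t * x) - 1) ∂ν
        - ∫ x : ℝ, (Complex.exp (Complex.I * (-s : ℝ) * x) - 1) ∂ν := by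
  rw [inner_expSubOneLp_left, ← integral_sub (hν.integrable_exp_sub_one _)
    (hν.integrable_exp_sub_one _)]
  refine Eq.trans ?_ (integral_sub ((hν.integrable_exp_sub_one _).sub
    (hν.integrable_exp_sub_one _)) (hν.integrable_exp_sub_one _))
  refine integral_congr_ae ?_
  filter_upwards [(hν.memLp_exp_sub_one t).coeFn_toLp] with x hx
  simp only [expSubOneLp, hx, ← exp_I_mul_mul_exp]
  ring

/-- The drift part of the exponent is additive and cancels; the defect of additivity of the jump
part is the inner product above. -/
theorem charFun_sub_eq {P : Measure ℝ} (hν : IsFiniteVariationJumpMeasure ν)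
    (hφ : ∀ u, charFun P u = levyCharFun Δ γ ν u) (s t : ℝ) :
    charFun P (t - s) = (starRingEnd ℂ) (charFun P s) * charFun P t *
      Complex.exp (Δ * inner ℂ (expSubOneLp hν s) (expSubOneLp hν t)) := by
  rw [← charFun_neg, hφ, hφ, hφ, inner_expSubOneLp]
  simp only [levyCharFun]
  rw [← Complex.exp_add, ← Complex.exp_add]
  congr 1
  push_cast
  ring

open scoped ComplexOrder

theorem sum_sum_star_mul_inner_mul {ι E : Type*} [NormedAddCommGroup E] [InnerProductSpace ℂ E]
    (v : ι → E) (c : ι →₀ ℂ) :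
    (c.sum fun i xi => c.sum fun j xj => star xi * inner ℂ (v i) (v j) * xj) =
      inner ℂ (Finsupp.linearCombination ℂ v c) (Finsupp.linearCombination ℂ v c) := by
  rw [Finsupp.linearCombination_apply, Finsupp.sum_inner]
  refine Finsupp.sum_congr fun i _ => ?_
  rw [inner_smul_left, Finsupp.inner_sum, Finsupp.sum, Finsupp.sum, Finset.mul_sum]
  refine Finset.sum_congr rfl fun j _ => ?_
  simp only [RCLike.star_def, inner_smul_right]
  ring

theorem posSemidef_inner {ι E : Type*} [NormedAddCommGroup E] [InnerProductSpace ℂ E] (v : ι → E) :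
    (Matrix.of fun i j => inner ℂ (v i) (v j)).PosSemidef := by
  refine ⟨Matrix.IsHermitian.ext fun i j => inner_conj_symm _ _, fun c => ?_⟩
  simp only [Matrix.of_apply]
  rw [sum_sum_star_mul_inner_mul, inner_self_eq_norm_sq_to_K]
  positivity

theorem norm_sq_linearCombination {ι E : Type*} [NormedAddCommGroup E] [InnerProductSpace ℂ E]
    (v : ι → E) (c : ι →₀ ℂ) :
    ‖Finsupp.linearCombination ℂ v c‖ ^ 2 =
      (c.sum fun i xi => c.sum fun j xj => star xi * inner ℂ (v i) (v j) * xj).re := by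
  rw [sum_sum_star_mul_inner_mul]
  exact (inner_self_eq_norm_sq (𝕜 := ℂ) _).symm

/-- Schur product theorem by induction on `n`, starting from the rank-one Gram matrix of the scalars
`a i`. -/
theorem posSemidef_mul_pow {ι E : Type*} [NormedAddCommGroup E] [InnerProductSpace ℂ E] (v : ι → E)
    (a : ι → ℂ) (n : ℕ) :
    (Matrix.of fun i j => (starRingEnd ℂ) (a i) * a j * inner ℂ (v i) (v j) ^ n).PosSemidef := by
  induction n with
  | zero =>
    have h := posSemidef_inner a
    simpa only [pow_zero, mul_one, one_mul, RCLike.inner_apply', mul_comm] using! h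
  | succ n ih =>
    have h := ih.hadamard (posSemidef_inner v)
    simpa only [Matrix.hadamard, Matrix.of_apply, mul_assoc, ← pow_succ] using! h

/-- The Poincaré inequality for trigonometric polynomials. -/
theorem norm_sq_score_le (hΔ : 0 ≤ Δ) (hν : IsFiniteVariationJumpMeasure ν)
    (hφ : ∀ u, charFun P u = levyCharFun Δ γ ν u) (c : ℝ →₀ ℂ) :
    Δ * ‖Finsupp.linearCombination ℂ (fun u => charFun P u • expSubOneLp hν u) c‖ ^ 2 ≤
      ‖Finsupp.linearCombination ℂ (expLp P) c‖ ^ 2 := by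
  set M : ℝ → ℝ → ℂ := fun s t => inner ℂ (expSubOneLp hν s) (expSubOneLp hν t) with hM
  set q : ℕ → ℂ := fun n => c.sum fun i xi => c.sum fun j xj =>
    star xi * ((starRingEnd ℂ) (charFun P i) * charFun P j * M i j ^ n) * xj with hq
  have hq0 : ∀ n, 0 ≤ (q n).re := fun n =>
    (Complex.nonneg_iff.mp ((posSemidef_mul_pow (expSubOneLp hν) (charFun P) n).2 c)).1
  -- The exponential in `charFun_sub_eq` is expanded in powers of the inner product, inside the
  -- quadratic form.
  have hsum : HasSum (fun n : ℕ => ((Δ : ℂ) ^ n / (n.factorial : ℂ)) * q n)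
      (c.sum fun i xi => c.sum fun j xj => star xi * inner ℂ (expLp P i) (expLp P j) * xj) := by
    simp only [hq, Finsupp.sum, Finset.mul_sum]
    refine hasSum_sum fun i _ => hasSum_sum fun j _ => ?_
    have := (NormedSpace.expSeries_div_hasSum_exp (𝔸 := ℂ) (Δ * M i j)).mul_left
      (star (c i) * ((starRingEnd ℂ) (charFun P i) * charFun P j) * c j)
    rw [← Complex.exp_eq_exp_ℂ] at this
    have hval : star (c i) * inner ℂ (expLp P i) (expLp P j) * c j = star (c i) *
        ((starRingEnd ℂ) (charFun P i) * charFun P j) * c j * Complex.exp (Δ * M i j) := by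
      rw [inner_expLp, charFun_sub_eq hν hφ]
      ring
    rw [hval]
    refine this.congr_fun ?_
    intro n
    simp only [mul_pow]
    ring
  have hre := Complex.hasSum_re hsum
  have hterm : ∀ n : ℕ, (((Δ : ℂ) ^ n / (n.factorial : ℂ)) * q n).re =
      Δ ^ n / n.factorial * (q n).re := fun n => by
    rw [show (Δ : ℂ) ^ n / (n.factorial : ℂ) = ((Δ ^ n / n.factorial : ℝ) : ℂ) by push_cast; rfl,
      Complex.re_ofReal_mul]
  simp only [hterm] at hre
  -- All terms are nonnegative, so the sum dominates the term `n = 1`, which is the left-hand side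
  -- of the claim.
  have hle := le_hasSum hre 1 fun n _ => mul_nonneg (by positivity) (hq0 n)
  rw [norm_sq_linearCombination, norm_sq_linearCombination]
  refine le_trans (le_of_eq ?_) hle
  simp only [pow_one, Nat.factorial_one, Nat.cast_one, div_one, hq]
  congr 2
  refine Finsupp.sum_congr fun i _ => Finsupp.sum_congr fun j _ => ?_
  rw [inner_smul_left, inner_smul_right]
  ring

/-- A function orthogonal to every character has zero Fourier transform, hence vanishes. -/
theorem denseRange_expLp (P : Measure ℝ) [IsProbabilityMeasure P] :
    DenseRange (Finsupp.linearCombination ℂ (expLp P)) := by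
  have h : (Submodule.span ℂ (Set.range (expLp P)))ᗮ = ⊥ := by
    rw [Submodule.eq_bot_iff]
    intro f hf
    have hint : Integrable f P := (Lp.memLp f).integrable (by norm_num)
    have hz : f =ᵐ[P] 0 := ae_eq_zero_of_char hint fun u => by
      have := (Submodule.mem_orthogonal _ _).mp hf (expLp P (-u))
        (Submodule.subset_span ⟨-u, rfl⟩)
      rwa [inner_expLp_left, neg_neg] at this
    exact (Lp.eq_zero_iff_ae_eq_zero).mpr hz
  rw [← Submodule.topologicalClosure_eq_top_iff] at h
  rw [DenseRange, ← LinearMap.coe_range, Finsupp.range_linearCombination,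
    dense_iff_closure_eq, ← Submodule.topologicalClosure_coe, h, Submodule.top_coe]

/-- The Fourier transform of `A b dP` is `Δ φ(u) ∫ b (exp (iu·) - 1) dν`. -/
def HasScoreTransform (Δ : ℝ) (ν P : Measure ℝ) [IsProbabilityMeasure P]
    (A : Lp ℝ 2 ν →L[ℝ] L20 P) : Prop :=
  ∀ (b : Lp ℝ 2 ν) (u : ℝ),
    ∫ y, ((A b : Lp ℝ 2 P) y : ℂ) * Complex.exp (Complex.I * u * y) ∂P =
      Δ * charFun P u * ∫ x, (b x : ℂ) * (Complex.exp (Complex.I * u * x) - 1) ∂ν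

/-- `D` is the adjoint of the bounded extension of `e_u ↦ φ(u)(e_u - 1)`; pairing `D b` with
`e_{-u}` reads off its transform. -/
theorem exists_adjoint_transform (hΔ : 0 < Δ) (hν : IsFiniteVariationJumpMeasure ν)
    (hφ : ∀ u, charFun P u = levyCharFun Δ γ ν u) :
    ∃ D : Lp ℂ 2 ν →L[ℂ] Lp ℂ 2 P, ∀ (b : Lp ℂ 2 ν) (u : ℝ),
      ∫ y, D b y * Complex.exp (Complex.I * u * y) ∂P =
        charFun P u * ∫ x, b x * (Complex.exp (Complex.I * u * x) - 1) ∂ν := by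
  set t := Finsupp.linearCombination ℂ (fun u => charFun P u • expSubOneLp hν u) with ht
  set e := Finsupp.linearCombination ℂ (expLp P) with he
  have hbound : ∀ c, ‖t c‖ ≤ (Real.sqrt Δ)⁻¹ * ‖e c‖ := fun c => by
    have h := Real.sqrt_le_sqrt (norm_sq_score_le hΔ.le hν hφ c)
    rw [Real.sqrt_mul hΔ.le, Real.sqrt_sq (norm_nonneg _), Real.sqrt_sq (norm_nonneg _)] at h
    rw [inv_mul_eq_div, le_div_iff₀ (Real.sqrt_pos.mpr hΔ), mul_comm]
    exact h
  set B : Lp ℂ 2 P →L[ℂ] Lp ℂ 2 ν := t.extendOfNorm e with hB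
  have hBe : ∀ u, B (expLp P u) = charFun P u • expSubOneLp hν u := fun u => by
    have := LinearMap.extendOfNorm_eq (denseRange_expLp P) ⟨_, hbound⟩ (Finsupp.single u 1)
    simpa [he, ht, hB] using this
  refine ⟨ContinuousLinearMap.adjoint B, fun b u => ?_⟩
  have h := ContinuousLinearMap.adjoint_inner_right B (expLp P (-u)) b
  rw [hBe, inner_smul_left, inner_expLp_left, inner_expSubOneLp_left, ← charFun_neg, neg_neg] at h
  exact h

theorem exists_hasScoreTransform (hΔ : 0 < Δ) (hν : IsFiniteVariationJumpMeasure ν)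
    (hφ : ∀ u, charFun P u = levyCharFun Δ γ ν u) :
    ∃ A : Lp ℝ 2 ν →L[ℝ] L20 P, HasScoreTransform Δ ν P A := by
  obtain ⟨D, hD⟩ := exists_adjoint_transform hΔ hν hφ
  -- For real `b` the transform of `D b` is Hermitian, so taking the real part does not change it.
  set A₀ : Lp ℝ 2 ν →L[ℝ] Lp ℝ 2 P := Δ • (Complex.reCLM.compLpL 2 P ∘L D.restrictScalars ℝ ∘L
    Complex.ofRealCLM.compLpL 2 ν) with hA₀
  have hcoe : ∀ b : Lp ℝ 2 ν, A₀ b =ᵐ[P] fun y => Δ * (D (Complex.ofRealCLM.compLp b) y).re :=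
    fun b => by
    filter_upwards [Lp.coeFn_smul Δ (Complex.reCLM.compLp (D (Complex.ofRealCLM.compLp b))),
      ContinuousLinearMap.coeFn_compLp Complex.reCLM (D (Complex.ofRealCLM.compLp b))] with y h1 h2
    exact h1.trans (by simp [h2])
  have key : ∀ (b : Lp ℝ 2 ν) (u : ℝ),
      ∫ y, (A₀ b y : ℂ) * Complex.exp (Complex.I * u * y) ∂P =
        Δ * charFun P u * ∫ x, (b x : ℂ) * (Complex.exp (Complex.I * u * x) - 1) ∂ν := by
    intro b u
    have hb : ∀ u : ℝ, ∫ x, (Complex.ofRealCLM.compLp b : Lp ℂ 2 ν) x *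
        (Complex.exp (Complex.I * u * x) - 1) ∂ν =
        ∫ x, (b x : ℂ) * (Complex.exp (Complex.I * u * x) - 1) ∂ν := fun u => by
      refine integral_congr_ae ?_
      filter_upwards [ContinuousLinearMap.coeFn_compLp Complex.ofRealCLM b] with x hx
      rw [hx, Complex.ofRealCLM_apply]
    have hint : Integrable (D (Complex.ofRealCLM.compLp b)) P :=
      (Lp.memLp _).integrable (by norm_num)
    have h1 : ∫ y, (A₀ b y : ℂ) * Complex.exp (Complex.I * u * y) ∂P =
        Δ * ∫ y, ((D (Complex.ofRealCLM.compLp b) y).re : ℂ) *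
          Complex.exp (Complex.I * u * y) ∂P := by
      rw [← integral_const_mul]
      refine integral_congr_ae ?_
      filter_upwards [hcoe b] with y hy
      rw [hy]
      push_cast
      ring
    have h2 : (starRingEnd ℂ) (∫ x, (b x : ℂ) * (Complex.exp (Complex.I * (-u : ℝ) * x) - 1) ∂ν) =
        ∫ x, (b x : ℂ) * (Complex.exp (Complex.I * u * x) - 1) ∂ν := by
      rw [← integral_conj]
      congr 1 with x
      rw [map_mul, map_sub, conj_exp_I_mul, neg_neg, map_one, Complex.conj_ofReal]
    rw [h1, integral_re_mul_exp hint, hD, hD, hb, hb, map_mul, h2, charFun_neg, Complex.conj_conj]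
    ring
  -- At `u = 0` the factor `e_u - 1` vanishes, which is the mean-zero condition.
  have hmem : ∀ b, A₀ b ∈ L20 P := fun b => by
    have := key b 0
    simp only [Complex.ofReal_zero, mul_zero, zero_mul, Complex.exp_zero, mul_one, sub_self,
      integral_zero] at this
    rw [integral_complex_ofReal] at this
    exact Complex.ofReal_eq_zero.mp this
  exact ⟨A₀.codRestrict (L20 P) hmem, key⟩

end construction

/-! ### Properties of the score operator -/

section score

variable {ν P : Measure ℝ} [IsProbabilityMeasure P] {Δ : ℝ} {A : Lp ℝ 2 ν →L[ℝ] L20 P}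

/-- Adding the constant `κ = Δ ∫ b dν` to `A b` removes the negative term. What remains is that `(A
b + κ) P` is the image of `Δ b(x) (ν ⊗ P)` under addition, and this is checked on transforms. -/
theorem HasScoreTransform.isScoreOperator [SFinite ν] (hA : HasScoreTransform Δ ν P A) :
    IsScoreOperator Δ ν P A := by
  intro b hb1 _ E hE
  have hb : Integrable b ν := memLp_one_iff_integrable.mp hb1
  have hAb : Integrable (A b : Lp ℝ 2 P) P := (Lp.memLp _).integrable (by norm_num)
  have hAbc : Integrable (fun y => ((A b : Lp ℝ 2 P) y : ℂ)) P := hAb.ofReal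
  have hbc : Integrable (fun x => (b x : ℂ)) ν := hb.ofReal
  set X : ℝ × ℝ → ℝ := fun p => p.1 + p.2 with hX
  have hXm : Measurable X := by fun_prop
  set κ : ℝ := Δ * ∫ x, b x ∂ν with hκ
  have hbp : Integrable (fun p : ℝ × ℝ => Δ * b p.1) (ν.prod P) := by
    simpa using (hb.const_mul Δ).mul_prod (integrable_const (1 : ℝ) (μ := P))
  have hchar := setIntegral_preimage_eq_of_char (X₁ := id) (X₂ := X)
    (f₁ := fun y => (A b : Lp ℝ 2 P) y + κ) measurable_id hXm
    (hAb.add (integrable_const κ)) hbp ?_ hE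
  · have h1 : ∫ y in E, (A b : Lp ℝ 2 P) y + κ ∂P =
        ∫ y in E, (A b : Lp ℝ 2 P) y ∂P + κ * P.real E := by
      rw [integral_add hAb.restrict (integrable_const κ).restrict, setIntegral_const, smul_eq_mul,
        mul_comm κ]
    have h2 : ∫ p in X ⁻¹' E, Δ * b p.1 ∂(ν.prod P) =
        Δ * ∫ x, b x * P.real {y | x + y ∈ E} ∂ν := by
      rw [← integral_indicator (hXm hE), integral_prod _ (hbp.indicator (hXm hE)),
        ← integral_const_mul]
      congr 1 with x
      have hS : MeasurableSet {y | x + y ∈ E} := (measurable_const_add x) hE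
      have : (fun y => (X ⁻¹' E).indicator (fun p : ℝ × ℝ => Δ * b p.1) (x, y)) =
          {y | x + y ∈ E}.indicator fun _ => Δ * b x := by
        ext y
        rfl
      rw [this, integral_indicator hS, setIntegral_const, smul_eq_mul]
      ring
    rw [Set.preimage_id, h1, h2] at hchar
    rw [eq_sub_of_add_eq hchar, hκ]
    ring
  · intro u
    have hbe : Integrable (fun x => (b x : ℂ) * Complex.exp (Complex.I * u * x)) ν :=
      integrable_mul_exp_I_mul hbc u
    have h1 : ∫ y, (((A b : Lp ℝ 2 P) y + κ : ℝ) : ℂ) *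
        Complex.exp (Complex.I * u * (id y : ℝ)) ∂P =
        ∫ y, ((A b : Lp ℝ 2 P) y : ℂ) * Complex.exp (Complex.I * u * y) ∂P +
          κ * charFun P u := by
      rw [charFun_eq_integral_exp, ← integral_const_mul, ← integral_add
        (integrable_mul_exp_I_mul hAbc u)
        (integrable_mul_exp_I_mul (integrable_const (κ : ℂ)) u)]
      congr 1 with y
      simp only [id_eq]
      push_cast
      ring
    have h2 : ∫ p, ((Δ * b p.1 : ℝ) : ℂ) * Complex.exp (Complex.I * u * (X p : ℝ)) ∂(ν.prod P) =
        Δ * ((∫ x, (b x : ℂ) * Complex.exp (Complex.I * u * x) ∂ν) * charFun P u) := by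
      rw [charFun_eq_integral_exp, ← integral_prod_mul, ← integral_const_mul]
      congr 1 with p
      rw [hX, exp_I_mul_add]
      push_cast
      ring
    have h3 : ∫ x, (b x : ℂ) * (Complex.exp (Complex.I * u * x) - 1) ∂ν =
        ∫ x, (b x : ℂ) * Complex.exp (Complex.I * u * x) ∂ν - ((∫ x, b x ∂ν : ℝ) : ℂ) := by
      rw [← integral_complex_ofReal, ← integral_sub hbe hbc]
      congr 1 with x
      ring
    rw [h1, h2, hA, h3, hκ]
    push_cast
    ring

theorem memLp_one_indicatorConstLp {s : Set ℝ} (hs : MeasurableSet s) (hμs : ν s ≠ ∞) (c : ℝ) :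
    MemLp (indicatorConstLp 2 hs hμs c) 1 ν :=
  (memLp_congr_ae indicatorConstLp_coeFn).mpr (memLp_indicator_const 1 hs c (Or.inr hμs))

theorem memLp_top_indicatorConstLp {s : Set ℝ} (hs : MeasurableSet s) (hμs : ν s ≠ ∞) (c : ℝ) :
    MemLp (indicatorConstLp 2 hs hμs c) ∞ ν :=
  (memLp_congr_ae indicatorConstLp_coeFn).mpr (memLp_indicator_const ∞ hs c (Or.inr hμs))

/-- The defining identity fixes the operator on indicators of sets of finite measure, which span a
dense subspace. -/
theorem IsScoreOperator.unique (hA : IsScoreOperator Δ ν P A) {A' : Lp ℝ 2 ν →L[ℝ] L20 P}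
    (hA' : IsScoreOperator Δ ν P A') : A' = A := by
  refine ContinuousLinearMap.ext fun f => ?_
  refine Lp.induction (p := 2) (by norm_num) (fun f => A' f = A f) ?_ ?_ ?_ f
  · intro c s hs hμs
    rw [Lp.simpleFunc.coe_indicatorConst]
    refine Subtype.ext (Lp.ext ?_)
    refine Lp.ae_eq_of_forall_setIntegral_eq _ _ (by norm_num) (by norm_num)
      (fun E _ _ => ((Lp.memLp _).integrable (by norm_num)).integrableOn)
      (fun E _ _ => ((Lp.memLp _).integrable (by norm_num)).integrableOn) fun E hE _ => ?_
    rw [hA _ (memLp_one_indicatorConstLp hs hμs.ne c) (memLp_top_indicatorConstLp hs hμs.ne c) E hE,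
      hA' _ (memLp_one_indicatorConstLp hs hμs.ne c) (memLp_top_indicatorConstLp hs hμs.ne c) E hE]
  · intro f g hf hg _ h1 h2
    rw [map_add, map_add, h1, h2]
  · exact isClosed_eq A'.continuous A.continuous

/-- By Fubini: for fixed `y` the slice is a translate of `N`, hence `ν`-null. -/
theorem ae_measure_translate_null [SFinite ν] (hν : ν ≪ volume) (P : Measure ℝ) [SFinite P]
    {N : Set ℝ} (hN : MeasurableSet N) (hN0 : volume N = 0) : ∀ᵐ x ∂ν, P {y | x + y ∈ N} = 0 := by
  have hS : MeasurableSet {p : ℝ × ℝ | p.1 + p.2 ∈ N} := measurable_fst.add measurable_snd hN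
  refine Measure.measure_ae_null_of_prod_null (s := {p : ℝ × ℝ | p.1 + p.2 ∈ N}) ?_
  rw [Measure.prod_apply_symm hS, lintegral_eq_zero_iff (measurable_measure_prodMk_right hS)]
  · filter_upwards with y
    refine hν ?_
    have : (fun x => (x, y)) ⁻¹' {p : ℝ × ℝ | p.1 + p.2 ∈ N} = (fun x => x + y) ⁻¹' N := rfl
    rw [this, measure_preimage_add_right, hN0]

theorem IsFiniteVariationJumpMeasure.exists_lt_real (hν : IsFiniteVariationJumpMeasure ν)
    (hinf : ν Set.univ = ∞) (C : ℝ) : ∃ S, MeasurableSet S ∧ ν S ≠ ∞ ∧ C < ν.real S := by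
  have hmono : Monotone fun n : ℕ => {x : ℝ | 1 / ((n : ℝ) + 1) ≤ |x|} := fun m n hmn x hx =>
    (one_div_le_one_div_of_le (by positivity)
      (by gcongr : (m : ℝ) + 1 ≤ (n : ℝ) + 1)).trans hx
  have htop : ν (⋃ n : ℕ, {x : ℝ | 1 / ((n : ℝ) + 1) ≤ |x|}) = ∞ := by
    rw [IsFiniteVariationJumpMeasure.iUnion_ge]
    have h := measure_add_measure_compl (μ := ν) (measurableSet_singleton (0 : ℝ))
    rwa [hν.singleton_zero, zero_add, hinf] at h
  have hlim := tendsto_measure_iUnion_atTop (μ := ν) hmono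
  rw [htop] at hlim
  obtain ⟨n, hn⟩ := (hlim.eventually (lt_mem_nhds (ENNReal.ofReal_lt_top (r := C)))).exists
  have hfin : ν {x : ℝ | 1 / ((n : ℝ) + 1) ≤ |x|} ≠ ∞ := (hν.measure_ge_lt_top (by positivity)).ne
  refine ⟨_, measurableSet_le measurable_const continuous_abs.measurable, hfin, ?_⟩
  exact (Real.le_coe_toNNReal C).trans_lt (ENNReal.toReal_strict_mono hfin hn)

/-- Existence of a score operator forces `P` to be absolutely continuous. -/
theorem IsScoreOperator.absolutelyContinuous (hA : IsScoreOperator Δ ν P A) (hΔ : 0 < Δ)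
    (hν : IsFiniteVariationJumpMeasure ν) (hinf : ν Set.univ = ∞) (hac : ν ≪ volume) :
    P ≪ volume := by
  have := hν.sigmaFinite
  refine Measure.AbsolutelyContinuous.mk fun N hN hN0 => ?_
  by_contra hPN
  have hp : 0 < P.real N := ENNReal.toReal_pos hPN (measure_ne_top _ _)
  -- For `b = 1_S`, Cauchy–Schwarz will give `Δ ν(S) P(N) ≤ ‖A‖ √(ν(S) P(N))`, that is `ν(S) P(N) ≤
  -- (‖A‖/Δ)²`. The mass of `S` is chosen to violate this.
  obtain ⟨S, hS, hSfin, hSl⟩ := hν.exists_lt_real hinf ((‖A‖ / Δ) ^ 2 / P.real N)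
  set b := indicatorConstLp 2 hS hSfin (1 : ℝ) with hb
  have hl : 0 ≤ ν.real S := measureReal_nonneg
  have h := hA b (memLp_one_indicatorConstLp hS hSfin 1) (memLp_top_indicatorConstLp hS hSfin 1) N hN
  -- The convolution with `bν` does not charge `N`, so only `-(∫ b dν) P` contributes there.
  have h1 : ∫ x, b x * P.real {y | x + y ∈ N} ∂ν = 0 := by
    refine integral_eq_zero_of_ae ?_
    filter_upwards [ae_measure_translate_null hac P hN hN0] with x hx
    simp [measureReal_def, hx]
  have h2 : ∫ x, b x ∂ν = ν.real S := by
    rw [integral_congr_ae indicatorConstLp_coeFn, integral_indicator hS]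
    simp
  rw [h1, h2, ← L2.inner_indicatorConstLp_one (𝕜 := ℝ) hN (measure_ne_top P N)] at h
  have h3 := abs_real_inner_le_norm (indicatorConstLp 2 hN (measure_ne_top P N) (1 : ℝ))
    (A b : Lp ℝ 2 P)
  have h4 : ‖(A b : Lp ℝ 2 P)‖ ≤ ‖A‖ * ‖b‖ := A.le_opNorm b
  have hn : ∀ {μ : Measure ℝ} {s : Set ℝ} (hs : MeasurableSet s) (hμs : μ s ≠ ∞),
      ‖indicatorConstLp 2 hs hμs (1 : ℝ)‖ = √(μ.real s) := fun hs hμs => by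
    rw [norm_indicatorConstLp (by norm_num) (by norm_num), Real.sqrt_eq_rpow]
    simp
  rw [h, hn] at h3
  rw [hb, hn] at h4
  have h5 : Δ * (ν.real S * P.real N) ≤ ‖A‖ * (√(ν.real S) * √(P.real N)) := by
    calc Δ * (ν.real S * P.real N) = |Δ * (0 - ν.real S * P.real N)| := by
          rw [zero_sub, mul_neg, abs_neg, abs_of_nonneg (by positivity)]
      _ ≤ √(P.real N) * ‖(A b : Lp ℝ 2 P)‖ := h3
      _ ≤ √(P.real N) * (‖A‖ * √(ν.real S)) := by gcongr
      _ = _ := by ring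
  have hlp : (‖A‖ / Δ) ^ 2 < ν.real S * P.real N := (div_lt_iff₀ hp).mp hSl
  rw [← Real.sqrt_mul hl] at h5
  set r := √(ν.real S * P.real N) with hr
  have hr1 : ‖A‖ / Δ < r := Real.lt_sqrt_of_sq_lt hlp
  have hr0 : 0 < r := lt_of_le_of_lt (by positivity) hr1
  have hr2 : ν.real S * P.real N = r * r := (Real.mul_self_sqrt (by positivity)).symm
  rw [hr2, ← mul_assoc] at h5
  have h6 := le_of_mul_le_mul_right h5 hr0
  rw [div_lt_iff₀ hΔ, mul_comm] at hr1
  linarith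

end score

/-! ### Fourier inversion -/

theorem exp_neg_I_mul (u x : ℝ) :
    Complex.exp (-(Complex.I * u * x)) = Complex.exp (Complex.I * (-x : ℝ) * u) := by
  congr 1
  push_cast
  ring

theorem integrable_exp_neg_mul {h : ℝ → ℂ} (hh : Integrable h volume) (x : ℝ) :
    Integrable (fun u : ℝ => Complex.exp (-(Complex.I * u * x)) * h u) volume := by
  simp only [exp_neg_I_mul, mul_comm _ (h _)]
  exact integrable_mul_exp_I_mul hh _

theorem continuous_fourierInv {h : ℝ → ℂ} (hh : Integrable h volume) :
    Continuous (fourierInv h) := by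
  refine continuous_const.mul (continuous_of_dominated (bound := fun u => ‖h u‖) ?_ ?_ hh.norm ?_)
  · exact fun x => (integrable_exp_neg_mul hh x).aestronglyMeasurable
  · intro x
    filter_upwards with u
    rw [norm_mul, exp_neg_I_mul, norm_exp_I_mul, one_mul]
  · filter_upwards with u
    fun_prop

theorem norm_fourierInv_le {h : ℝ → ℂ} (x : ℝ) :
    ‖fourierInv h x‖ ≤ (2 * Real.pi)⁻¹ * ∫ u, ‖h u‖ := by
  have h1 : ‖(2 * Real.pi : ℂ)⁻¹‖ = (2 * Real.pi)⁻¹ := by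
    rw [norm_inv, norm_mul, Complex.norm_real, Real.norm_of_nonneg Real.pi_pos.le]
    simp
  rw [fourierInv, norm_mul, h1]
  gcongr
  refine (norm_integral_le_integral_norm _).trans_eq ?_
  congr 1 with u
  rw [norm_mul, exp_neg_I_mul, norm_exp_I_mul, one_mul]

theorem fourierInv_congr_ae {h h' : ℝ → ℂ} (hh : h =ᵐ[volume] h') :
    fourierInv h = fourierInv h' := by
  ext x
  unfold fourierInv
  congr 1
  refine integral_congr_ae ?_
  filter_upwards [hh] with u hu
  rw [hu]

theorem conj_fourierInv (h : ℝ → ℂ) (x : ℝ) :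
    (starRingEnd ℂ) (fourierInv h x) = fourierInv (fun u => (starRingEnd ℂ) (h (-u))) x := by
  unfold fourierInv
  rw [map_mul, ← integral_conj, ← integral_neg_eq_self]
  congr 1
  · simp [Complex.conj_ofNat]
  · congr 1 with u
    rw [map_mul, ← Complex.exp_conj]
    simp

theorem fourierInv_const_mul (a : ℂ) (h : ℝ → ℂ) (x : ℝ) :
    fourierInv (fun u => a * h u) x = a * fourierInv h x := by
  unfold fourierInv
  simp only [mul_left_comm _ a]
  rw [integral_const_mul]
  ring

/-- Continuity upgrades the equality to every point, where uniqueness of transforms applies. -/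
theorem ae_eq_of_fourierInv_eq {h h' : ℝ → ℂ} (hh : Integrable h volume)
    (hh' : Integrable h' volume) (heq : fourierInv h =ᵐ[volume] fourierInv h') :
    h =ᵐ[volume] h' := by
  have heq' := Measure.eq_of_ae_eq heq (continuous_fourierInv hh) (continuous_fourierInv hh')
  have h0 : (fun u => h u - h' u) =ᵐ[volume] 0 := by
    refine ae_eq_zero_of_char (hh.sub hh') fun x => ?_
    have hx := congrFun heq' (-x)
    have h2 : (2 * Real.pi : ℂ)⁻¹ ≠ 0 :=
      inv_ne_zero (mul_ne_zero two_ne_zero (Complex.ofReal_ne_zero.mpr Real.pi_ne_zero))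
    have h3 := mul_left_cancel₀ h2 hx
    simp only [exp_neg_I_mul, neg_neg] at h3
    simp only [sub_mul]
    rw [integral_sub (integrable_mul_exp_I_mul hh x) (integrable_mul_exp_I_mul hh' x), sub_eq_zero]
    simpa only [mul_comm] using h3
  filter_upwards [h0] with u hu
  exact sub_eq_zero.mp hu

/-- Fubini for the inverse Fourier transform. -/
theorem integral_mul_fourierInv {ρ : Measure ℝ} [SFinite ρ] {f h : ℝ → ℂ} (hf : Integrable f ρ)
    (hh : Integrable h volume) :
    ∫ y, f y * fourierInv h y ∂ρ =
      (2 * Real.pi : ℂ)⁻¹ * ∫ u, h u * ∫ y, f y * Complex.exp (Complex.I * (-u : ℝ) * y) ∂ρ := by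
  unfold fourierInv
  simp only [mul_left_comm (f _)]
  rw [integral_const_mul]
  congr 1
  simp only [← integral_const_mul]
  rw [integral_integral_swap]
  · congr 1 with u
    congr 1 with y
    rw [show -(Complex.I * u * y) = Complex.I * (-u : ℝ) * y by push_cast; ring]
    ring
  · have h1 := hf.mul_prod hh
    refine (h1.mul_bdd (c := 1) (g := fun p : ℝ × ℝ => Complex.exp (-(Complex.I * p.2 * p.1)))
      (Continuous.aestronglyMeasurable (by fun_prop)) ?_).congr ?_
    · filter_upwards with p
      rw [exp_neg_I_mul, norm_exp_I_mul]
    · filter_upwards with p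
      simp only [Function.uncurry]
      ring

/-- Shifting by `y` multiplies the symbol by `exp(-iuy)`, whose `P`-average is `φ(-u)`. -/
theorem integral_fourierInv_add {P : Measure ℝ} [IsProbabilityMeasure P] {h : ℝ → ℂ}
    (hh : Integrable h volume) (x : ℝ) :
    ∫ y, fourierInv h (x + y) ∂P = fourierInv (fun u => charFun P (-u) * h u) x := by
  have hshift : ∀ y, fourierInv h (x + y) =
      fourierInv (fun u : ℝ => Complex.exp (-(Complex.I * u * x)) * h u) y := fun y => by
    unfold fourierInv
    congr 2 with u
    rw [← mul_assoc, ← Complex.exp_add]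
    congr 2
    push_cast
    ring
  have := integral_mul_fourierInv (integrable_const (1 : ℂ) (μ := P)) (integrable_exp_neg_mul hh x)
  simp only [one_mul, ← charFun_eq_integral_exp] at this
  simp only [hshift]
  rw [this, fourierInv]
  congr 2 with u
  ring

/-! ### Scaling between the two normalizations -/

theorem neg_div_two_pi_eq (u : ℝ) : -(u / (2 * Real.pi)) = -(2 * Real.pi)⁻¹ * u := by ring

theorem neg_inv_two_pi_ne_zero : -(2 * Real.pi)⁻¹ ≠ 0 := by
  have := Real.pi_pos
  exact neg_ne_zero.mpr (by positivity)

theorem quasiMeasurePreserving_mul_left {a : ℝ} (ha : a ≠ 0) :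
    Measure.QuasiMeasurePreserving (fun x : ℝ => a * x) volume volume := by
  refine ⟨by fun_prop, ?_⟩
  rw [Real.map_volume_mul_left ha]
  exact Measure.smul_absolutelyContinuous

theorem memLp_two_comp_mul_left {E : Type*} [NormedAddCommGroup E] {g : ℝ → E}
    (hg : MemLp g 2 volume) {a : ℝ} (ha : a ≠ 0) : MemLp (fun x => g (a * x)) 2 volume := by
  have hm := hg.1.comp_quasiMeasurePreserving (quasiMeasurePreserving_mul_left ha)
  exact (memLp_two_iff_integrable_sq_norm hm).mpr
    (((memLp_two_iff_integrable_sq_norm hg.1).mp hg).comp_mul_left' ha)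

/-- The inverse Fourier transform in Mathlib's normalization. -/
theorem integral_exp_two_pi_mul (g : ℝ → ℂ) (x : ℝ) :
    ∫ v : ℝ, Complex.exp (Complex.I * (2 * Real.pi * x : ℝ) * v) * g v =
      fourierInv (fun u => g (-(u / (2 * Real.pi)))) x := by
  have hpi := Real.pi_pos
  have h := Measure.integral_comp_mul_left
    (fun v : ℝ => Complex.exp (Complex.I * (2 * Real.pi * x : ℝ) * v) * g v) (-(2 * Real.pi)⁻¹)
  rw [inv_neg, inv_inv, abs_neg, abs_of_pos (by positivity)] at h
  rw [fourierInv]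
  have h2 : ∀ u : ℝ, Complex.exp (-(Complex.I * u * x)) * g (-(u / (2 * Real.pi))) =
      Complex.exp (Complex.I * (2 * Real.pi * x : ℝ) * (-(2 * Real.pi)⁻¹ * u : ℝ)) *
        g (-(2 * Real.pi)⁻¹ * u) := fun u => by
    rw [neg_div_two_pi_eq]
    congr 2
    have : (Real.pi : ℂ) ≠ 0 := Complex.ofReal_ne_zero.mpr hpi.ne'
    push_cast
    field_simp
  simp only [h2]
  rw [h, Complex.real_smul, ← mul_assoc]
  have : (2 * Real.pi : ℂ)⁻¹ * ((2 * Real.pi : ℝ) : ℂ) = 1 := by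
    push_cast
    exact inv_mul_cancel₀ (mul_ne_zero two_ne_zero (Complex.ofReal_ne_zero.mpr hpi.ne'))
  rw [this, one_mul]

open FourierTransform in
/-- The inverse Fourier transform on `L²` of an integrable function is given by the integral. -/
theorem fourierTransform_symm_ae_eq {h : Lp ℂ 2 (volume : Measure ℝ)} (hh : Integrable h volume) :
    ((Lp.fourierTransformₗᵢ ℝ ℂ).symm h : Lp ℂ 2 (volume : Measure ℝ)) =ᵐ[volume]
      fourierInv (fun u => h (-(u / (2 * Real.pi)))) := by
  set F : ℝ → ℂ := fourierInv (fun u => h (-(u / (2 * Real.pi)))) with hF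
  have hscale : Integrable (fun u => h (-(u / (2 * Real.pi)))) volume := by
    simp only [neg_div_two_pi_eq]
    exact hh.comp_mul_left' neg_inv_two_pi_ne_zero
  have hFc : Continuous F := continuous_fourierInv hscale
  set q : Lp ℂ 2 (volume : Measure ℝ) := (Lp.fourierTransformₗᵢ ℝ ℂ).symm h with hq
  have hqloc : LocallyIntegrable q volume := (Lp.memLp q).locallyIntegrable (by norm_num)
  -- The two sides are compared weakly. Against a test function the `L²` inverse transform moves
  -- onto the test function by duality, and Fubini moves it back onto the integral formula.
  have hzero := ae_eq_zero_of_integral_contDiff_smul_eq_zero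
    (hqloc.sub (hFc.locallyIntegrable (μ := volume))) ?_
  · filter_upwards [hzero] with x hx
    exact sub_eq_zero.mp hx
  · intro g hg hgc
    have hg₁ : HasCompactSupport (Complex.ofRealCLM ∘ g) := hgc.comp_left rfl
    have hg₂ : ContDiff ℝ (⊤ : ℕ∞) (Complex.ofRealCLM ∘ g) := Complex.ofRealCLM.contDiff.comp hg
    set G : SchwartzMap ℝ ℂ := hg₁.toSchwartzMap hg₂ with hG
    have hGapp : ∀ x, G x = (g x : ℂ) := fun x => rfl
    have hGint : Integrable G volume := G.integrable
    have hi1 : Integrable (fun x => g x • q x) volume :=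
      hqloc.integrable_smul_left_of_hasCompactSupport hg.continuous hgc
    have hi2 : Integrable (fun x => g x • F x) volume :=
      (hFc.locallyIntegrable (μ := volume)).integrable_smul_left_of_hasCompactSupport
        hg.continuous hgc
    have h1 : ∫ x, G x • q x = ∫ v, (𝓕⁻ G) v • h v := by
      have := congrArg (fun d => d G) (Lp.fourierInv_toTemperedDistribution_eq h)
      simp only [TemperedDistribution.fourierInv_apply, Lp.toTemperedDistribution_apply] at this
      exact this.symm
    have h2 : ∀ v : ℝ, (𝓕⁻ G) v =
        ∫ x : ℝ, Complex.exp (Complex.I * (2 * Real.pi * x : ℝ) * v) * G x := fun v => by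
      rw [SchwartzMap.fourierInv_coe, Real.fourierInv_eq']
      congr 1 with x
      rw [smul_eq_mul]
      congr 2
      rw [RCLike.inner_apply, conj_trivial]
      push_cast
      ring
    have h3 : ∫ v, (𝓕⁻ G) v • h v = ∫ x, G x • F x := by
      simp only [h2, smul_eq_mul, hF, ← integral_exp_two_pi_mul, ← integral_mul_const,
        ← integral_const_mul]
      rw [integral_integral_swap]
      · congr 1 with x
        congr 1 with v
        ring
      · refine ((hh.mul_prod hGint).mul_bdd (c := 1) (g := fun p : ℝ × ℝ =>
          Complex.exp (Complex.I * (2 * Real.pi * p.2 : ℝ) * p.1))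
          (Continuous.aestronglyMeasurable (by fun_prop)) ?_).congr ?_
        · filter_upwards with p
          rw [norm_exp_I_mul]
        · filter_upwards with p
          simp only [Function.uncurry]
          ring
    have h4 : ∫ x, g x • q x = ∫ x, G x • q x := by
      congr 1
    have h5 : ∫ x, g x • F x = ∫ x, G x • F x := by
      congr 1
    simp only [Pi.sub_apply, smul_sub]
    rw [integral_sub hi1 hi2, h4, h5, h1, h3, sub_self]

/-! ### The Fourier transform on real `L²` -/

theorem memLp_fourierL2 (f : Lp ℝ 2 (volume : Measure ℝ)) : MemLp (fourierL2 f) 2 volume := by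
  unfold fourierL2
  simp only [neg_div_two_pi_eq]
  exact memLp_two_comp_mul_left (Lp.memLp _) neg_inv_two_pi_ne_zero

theorem neg_two_pi_mul (v : ℝ) : -(-(2 * Real.pi) * v / (2 * Real.pi)) = v := by
  have := Real.pi_pos
  field_simp

theorem ae_eq_fourierInv_fourierL2 {f : Lp ℝ 2 (volume : Measure ℝ)}
    (hf : Integrable (fourierL2 f) volume) :
    (fun x => (f x : ℂ)) =ᵐ[volume] fourierInv (fourierL2 f) := by
  set H : Lp ℂ 2 (volume : Measure ℝ) :=
    Lp.fourierTransformₗᵢ ℝ ℂ (Complex.ofRealCLM.compLp f) with hH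
  have hpi := Real.pi_pos
  have hHint : Integrable H volume := by
    have := hf.comp_mul_left' (R := -(2 * Real.pi)) (by simp [hpi.ne'])
    simpa only [fourierL2, neg_two_pi_mul] using this
  have h1 := fourierTransform_symm_ae_eq hHint
  rw [hH, LinearIsometryEquiv.symm_apply_apply] at h1
  filter_upwards [h1, ContinuousLinearMap.coeFn_compLp Complex.ofRealCLM f] with x hx1 hx2
  rw [hx2] at hx1
  exact hx1

/-- The inversion formula reproduces a real function, so the transform and its reflected conjugate
have the same inverse transform. -/
theorem fourierL2_conj_symm {f : Lp ℝ 2 (volume : Measure ℝ)}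
    (hf : Integrable (fourierL2 f) volume) :
    ∀ᵐ u, fourierL2 f (-u) = (starRingEnd ℂ) (fourierL2 f u) := by
  have hc : Integrable (fun u => (starRingEnd ℂ) (fourierL2 f (-u))) volume :=
    (Complex.conjCLE : ℂ →L[ℝ] ℂ).integrable_comp hf.comp_neg
  have h1 := ae_eq_fourierInv_fourierL2 hf
  have h2 : fourierInv (fourierL2 f) =ᵐ[volume]
      fourierInv fun u => (starRingEnd ℂ) (fourierL2 f (-u)) := by
    filter_upwards [h1] with x hx
    rw [← conj_fourierInv, ← hx, Complex.conj_ofReal]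
  filter_upwards [ae_eq_of_fourierInv_eq hf hc h2] with u hu
  rw [hu, Complex.conj_conj]

theorem eq_of_fourierL2_ae_eq {f g : Lp ℝ 2 (volume : Measure ℝ)}
    (hf : Integrable (fourierL2 f) volume) (h : fourierL2 f =ᵐ[volume] fourierL2 g) : f = g := by
  refine Lp.ext ?_
  filter_upwards [ae_eq_fourierInv_fourierL2 hf, ae_eq_fourierInv_fourierL2 (hf.congr h)]
    with x h1 h2
  rw [fourierInv_congr_ae h, ← h2] at h1
  exact Complex.ofReal_injective h1

/-- Integrability gives the `L²` inverse transform a pointwise formula, from which Hermitian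
symmetry yields real values. -/
theorem exists_fourierL2_eq {h : ℝ → ℂ} (hi : Integrable h volume) (h2 : MemLp h 2 volume)
    (hsymm : ∀ᵐ u, h (-u) = (starRingEnd ℂ) (h u)) :
    ∃ f : Lp ℝ 2 (volume : Measure ℝ), fourierL2 f =ᵐ[volume] h := by
  have hpi := Real.pi_pos
  have hne : -(2 * Real.pi) ≠ 0 := by simp [hpi.ne']
  have hm := memLp_two_comp_mul_left h2 hne
  set H : Lp ℂ 2 (volume : Measure ℝ) := hm.toLp with hH
  have hHae := hm.coeFn_toLp
  have hback : (fun u => H (-(u / (2 * Real.pi)))) =ᵐ[volume] h := by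
    have := (quasiMeasurePreserving_mul_left neg_inv_two_pi_ne_zero).ae hHae
    filter_upwards [this] with u hu
    rw [neg_div_two_pi_eq, hH, hu]
    congr 1
    field_simp
  have hHint : Integrable H volume := (hi.comp_mul_left' hne).congr hHae.symm
  have hinv := fourierTransform_symm_ae_eq hHint
  rw [fourierInv_congr_ae hback] at hinv
  set G : Lp ℂ 2 (volume : Measure ℝ) := (Lp.fourierTransformₗᵢ ℝ ℂ).symm H with hG
  refine ⟨Complex.reCLM.compLp G, ?_⟩
  have hreal : ∀ x, (starRingEnd ℂ) (fourierInv h x) = fourierInv h x := fun x => by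
    rw [conj_fourierInv]
    refine congrFun (fourierInv_congr_ae ?_) x
    filter_upwards [hsymm] with u hu
    rw [hu, Complex.conj_conj]
  have hGG : Complex.ofRealCLM.compLp (Complex.reCLM.compLp G) = G := by
    refine Lp.ext ?_
    filter_upwards [ContinuousLinearMap.coeFn_compLp Complex.ofRealCLM (Complex.reCLM.compLp G),
      ContinuousLinearMap.coeFn_compLp Complex.reCLM G, hinv] with x hx1 hx2 hx3
    rw [hx1, hx2, hx3]
    exact Complex.conj_eq_iff_re.mp (hreal x)
  have : fourierL2 (Complex.reCLM.compLp G) = fun u => H (-(u / (2 * Real.pi))) := by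
    ext u
    rw [fourierL2, hGG, hG, LinearIsometryEquiv.apply_symm_apply]
  rw [this]
  exact hback

/-! ### Multipliers on `H^∞` -/

theorem continuous_weight (s : ℝ) : Continuous fun u : ℝ => (((1 + u ^ 2) ^ (s / 2) : ℝ) : ℂ) :=
  Complex.continuous_ofReal.comp
    ((by fun_prop : Continuous fun u : ℝ => 1 + u ^ 2).rpow_const
      fun u => Or.inl (by nlinarith [sq_nonneg u]))

theorem norm_weight (s u : ℝ) :
    ‖(((1 + u ^ 2) ^ (s / 2) : ℝ) : ℂ)‖ = (1 + u ^ 2) ^ (s / 2) := by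
  rw [Complex.norm_real, Real.norm_of_nonneg (by positivity)]

theorem weight_mul (r s u : ℝ) :
    (1 + u ^ 2) ^ (r / 2) * (1 + u ^ 2) ^ (s / 2) = (1 + u ^ 2) ^ ((r + s) / 2) := by
  rw [← Real.rpow_add (by positivity)]
  congr 1
  ring

theorem memLp_two_weight : MemLp (fun u : ℝ => (((1 + u ^ 2) ^ (-1 / 2 : ℝ) : ℝ) : ℂ)) 2 volume := by
  rw [memLp_two_iff_integrable_sq_norm (continuous_weight (-1)).aestronglyMeasurable]
  refine integrable_inv_one_add_sq.congr ?_
  filter_upwards with u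
  rw [norm_weight, sq ((1 + u ^ 2) ^ (-1 / 2 : ℝ)), weight_mul, ← Real.rpow_neg_one]
  norm_num

/-- One extra Sobolev order supplies the square integrable factor `(1 + u²)^{-1/2}`, so Hölder's
inequality passes from `L²` to `L¹`. -/
theorem integrable_weight_mul_fourierL2 {f : Lp ℝ 2 (volume : Measure ℝ)} (hf : f ∈ sobolevInfty)
    {s : ℝ} (hs : 0 ≤ s) :
    Integrable (fun u : ℝ => (((1 + u ^ 2) ^ (s / 2) : ℝ) : ℂ) * fourierL2 f u) volume := by
  have h := memLp_two_weight.integrable_mul (hf (s + 1) (by linarith))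
  refine h.congr ?_
  filter_upwards with u
  rw [Pi.mul_apply, ← mul_assoc, ← Complex.ofReal_mul, weight_mul]
  congr 4
  ring

theorem integrable_fourierL2 {f : Lp ℝ 2 (volume : Measure ℝ)} (hf : f ∈ sobolevInfty) :
    Integrable (fourierL2 f) volume := by
  simpa using integrable_weight_mul_fourierL2 hf le_rfl

/-- Growth of order `r` costs `r` derivatives, which is harmless in `H^∞`; Hermitian symmetry of `m`
keeps the result real. -/
theorem exists_multiplier {f : Lp ℝ 2 (volume : Measure ℝ)} (hf : f ∈ sobolevInfty) {m : ℝ → ℂ}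
    (hm : Measurable m) (hsymm : ∀ u, m (-u) = (starRingEnd ℂ) (m u)) {r C : ℝ} (hr : 0 ≤ r)
    (hC : ∀ u, ‖m u‖ ≤ C * (1 + u ^ 2) ^ (r / 2)) :
    ∃ f' ∈ sobolevInfty, fourierL2 f' =ᵐ[volume] fun u => m u * fourierL2 f u := by
  have hmeas : AEStronglyMeasurable (fun u => m u * fourierL2 f u) volume :=
    hm.aestronglyMeasurable.mul (memLp_fourierL2 f).1
  have hle : ∀ s u, ‖(((1 + u ^ 2) ^ (s / 2) : ℝ) : ℂ) * (m u * fourierL2 f u)‖ ≤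
      C * ‖(((1 + u ^ 2) ^ ((s + r) / 2) : ℝ) : ℂ) * fourierL2 f u‖ := fun s u => by
    rw [norm_mul, norm_mul, norm_mul, norm_weight, norm_weight, ← weight_mul]
    calc (1 + u ^ 2) ^ (s / 2) * (‖m u‖ * ‖fourierL2 f u‖)
        ≤ (1 + u ^ 2) ^ (s / 2) * (C * (1 + u ^ 2) ^ (r / 2) * ‖fourierL2 f u‖) := by
          gcongr
          exact hC u
      _ = _ := by ring
  have hmem : ∀ s : ℝ, 0 ≤ s →
      MemLp (fun u : ℝ => (((1 + u ^ 2) ^ (s / 2) : ℝ) : ℂ) * (m u * fourierL2 f u)) 2 volume :=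
    fun s hs => (hf (s + r) (by linarith)).of_le_mul (c := C)
      ((continuous_weight s).aestronglyMeasurable.mul hmeas) (by filter_upwards with u; exact hle s u)
  have hint : Integrable (fun u => m u * fourierL2 f u) volume := by
    refine ((integrable_weight_mul_fourierL2 hf hr).norm.const_mul C).mono' hmeas ?_
    filter_upwards with u
    simpa using hle 0 u
  have hint2 : MemLp (fun u => m u * fourierL2 f u) 2 volume := by simpa using hmem 0 le_rfl
  obtain ⟨f', hf'⟩ := exists_fourierL2_eq hint hint2 (by
    filter_upwards [fourierL2_conj_symm (integrable_fourierL2 hf)] with u hu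
    rw [hu, hsymm, map_mul])
  refine ⟨f', fun s hs => (memLp_congr_ae ?_).mpr (hmem s hs), hf'⟩
  filter_upwards [hf'] with u hu
  rw [hu]

/-! ### Test functions -/

open FourierTransform in
theorem exists_mem_sobolevInfty_ae_eq {g : ℝ → ℝ} (hg : ContDiff ℝ (⊤ : ℕ∞) g)
    (hgc : HasCompactSupport g) : ∃ f ∈ sobolevInfty, f =ᵐ[volume] g := by
  have hg₁ : HasCompactSupport (Complex.ofRealCLM ∘ g) := hgc.comp_left rfl
  have hg₂ : ContDiff ℝ (⊤ : ℕ∞) (Complex.ofRealCLM ∘ g) := Complex.ofRealCLM.contDiff.comp hg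
  set G : SchwartzMap ℝ ℂ := hg₁.toSchwartzMap hg₂ with hG
  have hGapp : ∀ x, G x = (g x : ℂ) := fun x => rfl
  have hmem : MemLp g 2 (volume : Measure ℝ) := hg.continuous.memLp_of_hasCompactSupport hgc
  refine ⟨hmem.toLp, fun s hs => ?_, hmem.coeFn_toLp⟩
  have hlp : Complex.ofRealCLM.compLp hmem.toLp = G.toLp 2 := by
    refine Lp.ext ?_
    filter_upwards [ContinuousLinearMap.coeFn_compLp Complex.ofRealCLM hmem.toLp,
      hmem.coeFn_toLp, G.coeFn_toLp 2] with x h1 h2 h3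
    rw [h1, h2, h3, hGapp, Complex.ofRealCLM_apply]
  have hF : fourierL2 hmem.toLp =ᵐ[volume] fun u => (𝓕 G) (-(2 * Real.pi)⁻¹ * u) := by
    have h1 : (Lp.fourierTransformₗᵢ ℝ ℂ (Complex.ofRealCLM.compLp hmem.toLp) :
        Lp ℂ 2 (volume : Measure ℝ)) = (𝓕 G).toLp 2 := by
      rw [hlp]
      exact SchwartzMap.toLp_fourier_eq G
    have h2 := (quasiMeasurePreserving_mul_left neg_inv_two_pi_ne_zero).ae
      ((𝓕 G).coeFn_toLp 2 volume)
    filter_upwards [h2] with u hu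
    rw [fourierL2, h1, neg_div_two_pi_eq, hu]
  -- Decay of order `s + 1` rather than `s` leaves the factor `(1 + u²)^{-1/2}`, which lies in `L²`.
  set k : ℕ := ⌈s + 1⌉₊ with hk
  have hsk : s + 1 ≤ k := Nat.le_ceil _
  obtain ⟨D, hD⟩ : ∃ D, ∀ v : ℝ, (1 + |v|) ^ k * ‖(𝓕 G) v‖ ≤ D := by
    have h := SchwartzMap.one_add_le_sup_seminorm_apply (𝕜 := ℝ) (m := (k, 0)) le_rfl le_rfl (𝓕 G)
    simp only [norm_iteratedFDeriv_zero, Real.norm_eq_abs] at h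
    exact ⟨_, h⟩
  have hweight : ∀ u : ℝ, (1 + u ^ 2) ^ ((s + 1) / 2) ≤
      (2 * Real.pi) ^ k * (1 + |-(2 * Real.pi)⁻¹ * u|) ^ k := fun u => by
    have hpi := Real.two_le_pi
    have h1 : (1 + u ^ 2) ≤ (1 + |u|) ^ 2 := by nlinarith [abs_nonneg u, sq_abs u]
    have h2 : 1 + |u| ≤ 2 * Real.pi * (1 + |-(2 * Real.pi)⁻¹ * u|) := by
      have h3 : (0 : ℝ) < 2 * Real.pi := by positivity
      rw [abs_mul, abs_neg, abs_of_pos (inv_pos.mpr h3), mul_add, ← mul_assoc,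
        mul_inv_cancel₀ h3.ne']
      linarith
    calc (1 + u ^ 2) ^ ((s + 1) / 2) ≤ ((1 + |u|) ^ 2) ^ ((s + 1) / 2) := by gcongr
      _ = (1 + |u|) ^ (s + 1) := by
          rw [← Real.rpow_natCast, ← Real.rpow_mul (by positivity)]
          congr 1
          push_cast
          ring
      _ ≤ (1 + |u|) ^ (k : ℝ) := Real.rpow_le_rpow_of_exponent_le (by linarith [abs_nonneg u]) hsk
      _ = (1 + |u|) ^ k := Real.rpow_natCast _ _
      _ ≤ (2 * Real.pi * (1 + |-(2 * Real.pi)⁻¹ * u|)) ^ k := by gcongr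
      _ = _ := mul_pow _ _ _
  refine memLp_two_weight.of_le_mul (c := (2 * Real.pi) ^ k * D)
    ((continuous_weight s).aestronglyMeasurable.mul (memLp_fourierL2 _).1) ?_
  filter_upwards [hF] with u hu
  have hpos : (0 : ℝ) < (1 + u ^ 2) ^ (-1 / 2 : ℝ) := by positivity
  rw [hu, norm_mul, norm_weight, norm_weight,
    show (1 + u ^ 2) ^ (s / 2) = (1 + u ^ 2) ^ ((s + 1) / 2) * (1 + u ^ 2) ^ (-1 / 2 : ℝ) by
      rw [weight_mul]; congr 1; ring, mul_right_comm]
  refine mul_le_mul_of_nonneg_right ?_ hpos.le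
  calc (1 + u ^ 2) ^ ((s + 1) / 2) * ‖(𝓕 G) (-(2 * Real.pi)⁻¹ * u)‖
      ≤ (2 * Real.pi) ^ k * (1 + |-(2 * Real.pi)⁻¹ * u|) ^ k * ‖(𝓕 G) (-(2 * Real.pi)⁻¹ * u)‖ := by
        gcongr
        exact hweight u
    _ ≤ (2 * Real.pi) ^ k * D := by
        rw [mul_assoc]
        gcongr
        exact hD _

/-! ### The continuous version of a function in `H^∞` -/

/-- The continuous version of `f ∈ H^∞`. -/
def contVersion (f : Lp ℝ 2 (volume : Measure ℝ)) (x : ℝ) : ℝ := (fourierInv (fourierL2 f) x).re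

section contVersion

variable {f : Lp ℝ 2 (volume : Measure ℝ)}

theorem continuous_contVersion (hf : f ∈ sobolevInfty) : Continuous (contVersion f) :=
  Complex.continuous_re.comp (continuous_fourierInv (integrable_fourierL2 hf))

theorem ofReal_contVersion (hf : f ∈ sobolevInfty) (x : ℝ) :
    (contVersion f x : ℂ) = fourierInv (fourierL2 f) x := by
  refine Complex.conj_eq_iff_re.mp ?_
  rw [conj_fourierInv]
  refine congrFun (fourierInv_congr_ae ?_) x
  filter_upwards [fourierL2_conj_symm (integrable_fourierL2 hf)] with u hu
  rw [hu, Complex.conj_conj]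

theorem ae_eq_contVersion (hf : f ∈ sobolevInfty) : f =ᵐ[volume] contVersion f := by
  filter_upwards [ae_eq_fourierInv_fourierL2 (integrable_fourierL2 hf)] with x hx
  rw [contVersion, ← hx, Complex.ofReal_re]

theorem exists_abs_contVersion_le (f : Lp ℝ 2 (volume : Measure ℝ)) :
    ∃ C, ∀ x, |contVersion f x| ≤ C :=
  ⟨_, fun x => (Complex.abs_re_le_norm _).trans (norm_fourierInv_le x)⟩

theorem ae_shift_eq_contVersion {P : Measure ℝ} (hP : P ≪ volume) (hf : f ∈ sobolevInfty) (x : ℝ) :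
    (fun y => f (x + y)) =ᵐ[P] fun y => contVersion f (x + y) :=
  hP.ae_le ((measurePreserving_add_left volume x).quasiMeasurePreserving.ae (ae_eq_contVersion hf))

theorem integrable_shift {P : Measure ℝ} [IsFiniteMeasure P] (hP : P ≪ volume)
    (hf : f ∈ sobolevInfty) (x : ℝ) : Integrable (fun y => f (x + y)) P := by
  obtain ⟨C, hC⟩ := exists_abs_contVersion_le f
  refine Integrable.congr ?_ (ae_shift_eq_contVersion hP hf x).symm
  exact (integrable_const C).mono' ((continuous_contVersion hf).comp
    (continuous_const_add x)).aestronglyMeasurable (by filter_upwards with y; exact hC _)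

theorem memLp_two_of_mem_sobolevInfty {P : Measure ℝ} [IsFiniteMeasure P] (hP : P ≪ volume)
    (hf : f ∈ sobolevInfty) : MemLp f 2 P := by
  obtain ⟨C, hC⟩ := exists_abs_contVersion_le f
  refine (memLp_congr_ae (hP.ae_le (ae_eq_contVersion hf))).mpr ?_
  exact MemLp.of_bound (continuous_contVersion hf).aestronglyMeasurable C
    (by filter_upwards with y; exact hC _)

theorem ofReal_reflConv {P : Measure ℝ} [IsProbabilityMeasure P] (hP : P ≪ volume)
    (hf : f ∈ sobolevInfty) (x : ℝ) :
    (reflConv P f x : ℂ) = fourierInv (fun u => charFun P (-u) * fourierL2 f u) x := by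
  rw [← integral_fourierInv_add (integrable_fourierL2 hf), reflConv, ← integral_complex_ofReal]
  refine integral_congr_ae ?_
  filter_upwards [ae_shift_eq_contVersion hP hf x] with y hy
  rw [hy, ofReal_contVersion hf]

/-- The function `(2 + |u|) |F f(u)|` is integrable, and the character bound is integrated against
it. -/
theorem exists_abs_contVersion_sub_le (hf : f ∈ sobolevInfty) :
    ∃ C, ∀ x, |contVersion f x - contVersion f 0| ≤ C * min |x| 1 := by
  have hi := integrable_fourierL2 hf
  have hw : Integrable (fun u : ℝ => (2 + |u|) * ‖fourierL2 f u‖) volume := by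
    refine ((integrable_weight_mul_fourierL2 hf zero_le_two).norm.const_mul 3).mono'
      ((by fun_prop : Continuous fun u : ℝ => 2 + |u|).aestronglyMeasurable.mul
        hi.1.norm) ?_
    filter_upwards with u
    rw [norm_mul, norm_norm, norm_mul, norm_weight, ← mul_assoc,
      Real.norm_of_nonneg (by positivity)]
    gcongr
    rw [div_self two_ne_zero, Real.rpow_one]
    nlinarith [sq_abs u, abs_nonneg u, sq_nonneg (|u| - 1)]
  refine ⟨(2 * Real.pi)⁻¹ * ∫ u : ℝ, (2 + |u|) * ‖fourierL2 f u‖, fun x => ?_⟩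
  have h1 : |contVersion f x - contVersion f 0| =
      ‖fourierInv (fourierL2 f) x - fourierInv (fourierL2 f) 0‖ := by
    rw [← ofReal_contVersion hf, ← ofReal_contVersion hf, ← Complex.ofReal_sub, Complex.norm_real,
      Real.norm_eq_abs]
  have h2 : ‖(2 * Real.pi : ℂ)⁻¹‖ = (2 * Real.pi)⁻¹ := by
    rw [norm_inv, norm_mul, Complex.norm_real, Real.norm_of_nonneg Real.pi_pos.le]
    simp
  rw [h1, fourierInv, fourierInv, ← mul_sub, norm_mul, h2, mul_assoc,
    ← integral_sub (integrable_exp_neg_mul hi x) (integrable_exp_neg_mul hi 0),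
    ← integral_mul_const]
  gcongr
  refine (norm_integral_le_integral_norm _).trans (integral_mono_of_nonneg
    (by filter_upwards with u; positivity) (hw.mul_const _) ?_)
  filter_upwards with u
  have h3 := norm_exp_I_mul_sub_one_le u (-x)
  rw [abs_neg] at h3
  have h4 : Complex.exp (-(Complex.I * u * x)) - Complex.exp (-(Complex.I * u * (0 : ℝ))) =
      Complex.exp (Complex.I * u * (-x : ℝ)) - 1 := by simp
  rw [← sub_mul, norm_mul, h4, mul_right_comm (2 + |u|)]
  exact mul_le_mul_of_nonneg_right h3 (norm_nonneg _)

theorem memLp_jump {ν : Measure ℝ} (hν : IsFiniteVariationJumpMeasure ν) (hac : ν ≪ volume)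
    (hf : f ∈ sobolevInfty) (h0 : contVersion f 0 = 0) : MemLp f 1 ν ∧ MemLp f 2 ν := by
  obtain ⟨C, hC⟩ := exists_abs_contVersion_sub_le hf
  simp only [h0, sub_zero] at hC
  have hae := hac.ae_le (ae_eq_contVersion hf)
  have hm := (continuous_contVersion hf).aestronglyMeasurable (μ := ν)
  exact ⟨(memLp_congr_ae hae).mpr (memLp_one_iff_integrable.mpr (hν.integrable_of_le hm hC)),
    (memLp_congr_ae hae).mpr (hν.memLp_two_of_le hm hC)⟩

/-- Integrability against `ν` is automatic: a function of `H^∞` vanishing at `0` is `O(|x| ∧ 1)`. -/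
theorem mem_setH_iff {ν : Measure ℝ} (hν : IsFiniteVariationJumpMeasure ν) (hac : ν ≪ volume) :
    f ∈ setH ν ↔ f ∈ sobolevInfty ∧ contVersion f 0 = 0 := by
  constructor
  · rintro ⟨hf, ⟨c, hc, hfc, hc0⟩, -⟩
    have := Measure.eq_of_ae_eq (hfc.symm.trans (ae_eq_contVersion hf)) hc
      (continuous_contVersion hf)
    exact ⟨hf, by rw [← this, hc0]⟩
  · rintro ⟨hf, h0⟩
    exact ⟨hf, ⟨_, continuous_contVersion hf, ae_eq_contVersion hf, h0⟩, memLp_jump hν hac hf h0⟩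

theorem mem_setG_iff {P : Measure ℝ} [IsFiniteMeasure P] (hP : P ≪ volume) :
    f ∈ setG P ↔ f ∈ sobolevInfty ∧ ∫ x, f x ∂P = 0 :=
  ⟨fun h => ⟨h.1, h.2.2⟩, fun h => ⟨h.1, memLp_two_of_mem_sobolevInfty hP h.1, h.2⟩⟩

end contVersion

/-! ### The convolution as a Fourier multiplier -/

section multiplier

variable {P : Measure ℝ} [IsProbabilityMeasure P] {Δ : ℝ} {g b : Lp ℝ 2 (volume : Measure ℝ)}

theorem contVersion_eq_reflConv (hP : P ≪ volume) (hg : g ∈ sobolevInfty) (hb : b ∈ sobolevInfty)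
    (h : fourierL2 b =ᵐ[volume] fun u => Δ * charFun P (-u) * fourierL2 g u) (x : ℝ) :
    contVersion b x = Δ * reflConv P g x := by
  apply Complex.ofReal_injective
  rw [ofReal_contVersion hb, fourierInv_congr_ae h, Complex.ofReal_mul, ofReal_reflConv hP hg,
    ← fourierInv_const_mul]
  simp only [mul_assoc]

/-- This matches the side conditions of the two spaces: for `Δ ≠ 0`, the image vanishes at `0`
exactly when `g` has `P`-mean zero. -/
theorem contVersion_zero_eq (hP : P ≪ volume) (hg : g ∈ sobolevInfty) (hb : b ∈ sobolevInfty)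
    (h : fourierL2 b =ᵐ[volume] fun u => Δ * charFun P (-u) * fourierL2 g u) :
    contVersion b 0 = Δ * ∫ y, g y ∂P := by
  rw [contVersion_eq_reflConv hP hg hb h, reflConv]
  simp only [zero_add]

theorem exists_mul_charFun (hg : g ∈ sobolevInfty) (P : Measure ℝ) [IsProbabilityMeasure P]
    (Δ : ℝ) : ∃ b ∈ sobolevInfty,
      fourierL2 b =ᵐ[volume] fun u => Δ * charFun P (-u) * fourierL2 g u := by
  refine exists_multiplier hg (m := fun u => Δ * charFun P (-u)) (r := 0) (C := |Δ|)
    ((measurable_charFun.comp measurable_neg).const_mul _) (fun u => ?_) le_rfl fun u => ?_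
  · rw [map_mul, Complex.conj_ofReal, ← charFun_neg]
  · rw [norm_mul, Complex.norm_real, Real.norm_eq_abs, zero_div, Real.rpow_zero]
    gcongr
    exact norm_charFun_le_one _

/-- The lower bound on `φ` makes `1/φ(-u)` grow at most like `(1 + |u|)^β`, so division is an
admissible multiplier; the factor `2^{β/2}` comes from `(1 + |u|)² ≤ 2(1 + u²)`. -/
theorem exists_div_charFun (hb : b ∈ sobolevInfty) (hΔ : 0 < Δ) {β c : ℝ} (hβ : 0 < β) (hc : 0 < c)
    (hφ : ∀ u : ℝ, c * (1 + |u|) ^ (-β) ≤ ‖charFun P u‖) :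
    ∃ g ∈ sobolevInfty, fourierL2 b =ᵐ[volume] fun u => Δ * charFun P (-u) * fourierL2 g u := by
  have hsymm : ∀ u, ((Δ : ℂ) * charFun P (- -u))⁻¹ =
      (starRingEnd ℂ) ((Δ : ℂ) * charFun P (-u))⁻¹ := fun u => by
    rw [map_inv₀, map_mul, Complex.conj_ofReal, ← charFun_neg]
  have hbound : ∀ u : ℝ, ‖((Δ : ℂ) * charFun P (-u))⁻¹‖ ≤
      Δ⁻¹ * (c⁻¹ * 2 ^ (β / 2)) * (1 + u ^ 2) ^ (β / 2) := fun u => by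
    rw [norm_inv, norm_mul, mul_inv, Complex.norm_real, Real.norm_of_nonneg hΔ.le, mul_assoc,
      mul_assoc]
    gcongr
    calc ‖charFun P (-u)‖⁻¹ ≤ (c * (1 + |u|) ^ (-β))⁻¹ := by
          have := hφ (-u)
          rw [abs_neg] at this
          gcongr
      _ = c⁻¹ * ((1 + |u|) ^ 2) ^ (β / 2) := by
          rw [mul_inv, Real.rpow_neg (by positivity), inv_inv, ← Real.rpow_natCast,
            ← Real.rpow_mul (by positivity)]
          congr 2
          push_cast
          ring
      _ ≤ c⁻¹ * (2 * (1 + u ^ 2)) ^ (β / 2) := by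
          gcongr
          nlinarith [sq_abs u, sq_nonneg (|u| - 1)]
      _ = c⁻¹ * (2 ^ (β / 2) * (1 + u ^ 2) ^ (β / 2)) := by
          rw [Real.mul_rpow (by positivity) (by positivity)]
  obtain ⟨g, hg, hgb⟩ := exists_multiplier hb
    ((measurable_charFun.comp measurable_neg).const_mul (Δ : ℂ)).inv hsymm hβ.le hbound
  refine ⟨g, hg, ?_⟩
  filter_upwards [hgb] with u hu
  have h0 : charFun P (-u) ≠ 0 := norm_pos_iff.mp (lt_of_lt_of_le (by positivity) (hφ (-u)))
  rw [hu]
  exact (mul_inv_cancel_left₀ (mul_ne_zero (Complex.ofReal_ne_zero.mpr hΔ.ne') h0) _).symm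

/-- Convolution with `Δ P(-·)` is a bijection from `G` onto `H`. -/
theorem exists_equiv {ν : Measure ℝ} (hP : P ≪ volume) (hν : IsFiniteVariationJumpMeasure ν)
    (hac : ν ≪ volume) (hΔ : 0 < Δ) {β c : ℝ} (hβ : 0 < β) (hc : 0 < c)
    (hφ : ∀ u : ℝ, c * (1 + |u|) ^ (-β) ≤ ‖charFun P u‖) :
    ∃ T : setG P ≃ setH ν, ∀ g : setG P, fourierL2 (T g) =ᵐ[volume]
      fun u => Δ * charFun P (-u) * fourierL2 g u := by
  have hex : ∀ g : setG P, ∃ b : setH ν, fourierL2 b =ᵐ[volume]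
      fun u => Δ * charFun P (-u) * fourierL2 g u := fun g => by
    obtain ⟨b, hb, hbg⟩ := exists_mul_charFun g.2.1 P Δ
    refine ⟨⟨b, (mem_setH_iff hν hac).mpr ⟨hb, ?_⟩⟩, hbg⟩
    rw [contVersion_zero_eq hP g.2.1 hb hbg, g.2.2.2, mul_zero]
  choose T hT using hex
  have hne : ∀ u, (Δ : ℂ) * charFun P (-u) ≠ 0 := fun u =>
    mul_ne_zero (Complex.ofReal_ne_zero.mpr hΔ.ne')
      (norm_pos_iff.mp (lt_of_lt_of_le (by positivity) (hφ (-u))))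
  refine ⟨Equiv.ofBijective T ⟨fun g g' hgg' => ?_, fun b => ?_⟩, hT⟩
  · refine Subtype.ext (eq_of_fourierL2_ae_eq (integrable_fourierL2 g.2.1) ?_)
    have h' := hT g'
    rw [← hgg'] at h'
    filter_upwards [hT g, h'] with u h1 h2
    exact mul_left_cancel₀ (hne u) (h1.symm.trans h2)
  · obtain ⟨hb, hb0⟩ := (mem_setH_iff hν hac).mp b.2
    obtain ⟨g, hg, hgb⟩ := exists_div_charFun (P := P) hb hΔ hβ hc hφ
    rw [contVersion_zero_eq hP hg hb hgb] at hb0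
    have hgG : g ∈ setG P :=
      (mem_setG_iff hP).mpr ⟨hg, (mul_eq_zero.mp hb0).resolve_left hΔ.ne'⟩
    refine ⟨⟨g, hgG⟩, Subtype.ext (eq_of_fourierL2_ae_eq
      (integrable_fourierL2 (T ⟨g, hgG⟩).2.1) ((hT ⟨g, hgG⟩).trans hgb.symm))⟩

end multiplier

/-! ### The adjoint on `G` -/

/-- Both functions are integrated over a set `s` of finite `ν`-measure. The transform of `A 1_s` on
one side and Fourier inversion of `b` on the other lead to the same integral in `u`. -/
theorem adjoint_toL20_ae_eq {ν P : Measure ℝ} [IsProbabilityMeasure P] {Δ : ℝ}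
    {A : Lp ℝ 2 ν →L[ℝ] L20 P} (hA : HasScoreTransform Δ ν P A) (hP : P ≪ volume)
    (hν : IsFiniteVariationJumpMeasure ν) (hac : ν ≪ volume) (g : setG P) (b : setH ν)
    (h : fourierL2 b =ᵐ[volume] fun u => Δ * charFun P (-u) * fourierL2 g u) :
    (ContinuousLinearMap.adjoint A (toL20 g) : ℝ → ℝ) =ᵐ[ν] (b : Lp ℝ 2 (volume : Measure ℝ)) := by
  obtain ⟨hb, hb0⟩ := (mem_setH_iff hν hac).mp b.2
  have hg := g.2.1
  have hhg := integrable_fourierL2 hg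
  have hhb := integrable_fourierL2 hb
  have hae := hac.ae_le (ae_eq_contVersion hb)
  have hb2 : MemLp (b : Lp ℝ 2 (volume : Measure ℝ)) 2 ν := b.2.2.2.2
  refine EventuallyEq.trans (Lp.ae_eq_of_forall_setIntegral_eq (p := 2) _ hb2.toLp (by norm_num)
    (by norm_num) (fun s _ hs => integrableOn_Lp_of_measure_ne_top _ (by norm_num) hs.ne)
    (fun s _ hs => integrableOn_Lp_of_measure_ne_top _ (by norm_num) hs.ne) fun s hs hνs => ?_)
    hb2.coeFn_toLp
  have : IsFiniteMeasure (ν.restrict s) := ⟨by simpa using hνs⟩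
  set w := indicatorConstLp 2 hs hνs.ne (1 : ℝ) with hw
  have hAw : Integrable (fun y => ((A w : Lp ℝ 2 P) y : ℂ)) P :=
    ((Lp.memLp (A w : Lp ℝ 2 P)).integrable (by norm_num)).ofReal
  have hψ : ∀ u : ℝ, ∫ x, (w x : ℂ) * (Complex.exp (Complex.I * u * x) - 1) ∂ν =
      charFun (ν.restrict s) u - ν.real s := fun u => by
    have h1 : ∫ x, (w x : ℂ) * (Complex.exp (Complex.I * u * x) - 1) ∂ν =
        ∫ x in s, (Complex.exp (Complex.I * u * x) - 1) ∂ν := by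
      rw [← integral_indicator hs]
      refine integral_congr_ae ?_
      filter_upwards [indicatorConstLp_coeFn (p := 2) (hs := hs) (hμs := hνs.ne) (c := (1 : ℝ))]
        with x hx
      rw [hw, hx]
      by_cases hxs : x ∈ s <;> simp [hxs]
    have h2 : Integrable (fun x : ℝ => Complex.exp (Complex.I * u * x)) (ν.restrict s) := by
      simpa using integrable_mul_exp_I_mul (integrable_const (1 : ℂ) (μ := ν.restrict s)) u
    rw [h1, integral_sub h2 (integrable_const _), charFun_eq_integral_exp, setIntegral_const]
    simp
  apply Complex.ofReal_injective
  have hL : ((∫ x in s, ContinuousLinearMap.adjoint A (toL20 g) x ∂ν : ℝ) : ℂ) =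
      (2 * Real.pi : ℂ)⁻¹ * ∫ u, fourierL2 b u * (charFun (ν.restrict s) (-u) - ν.real s) := by
    rw [← L2.inner_indicatorConstLp_one (𝕜 := ℝ) hs hνs.ne, ContinuousLinearMap.adjoint_inner_right,
      Submodule.coe_inner, L2.inner_def, ← integral_complex_ofReal]
    have h1 : ∫ y, ((inner ℝ ((A w : Lp ℝ 2 P) y) ((toL20 g : Lp ℝ 2 P) y) : ℝ) : ℂ) ∂P =
        ∫ y, ((A w : Lp ℝ 2 P) y : ℂ) * fourierInv (fourierL2 g) y ∂P := by
      refine integral_congr_ae ?_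
      filter_upwards [g.2.2.1.coeFn_toLp, hP.ae_le (ae_eq_contVersion hg)] with y hy1 hy2
      have hy3 : (toL20 g : Lp ℝ 2 P) y = contVersion g y := hy1.trans hy2
      rw [hy3, ← ofReal_contVersion hg, ← Complex.ofReal_mul, RCLike.inner_apply, conj_trivial,
        mul_comm]
    rw [h1, integral_mul_fourierInv hAw hhg]
    congr 1
    refine integral_congr_ae ?_
    filter_upwards [h] with u hu
    rw [hA, hψ, hu]
    ring
  have hR : ((∫ x in s, (hb2.toLp : Lp ℝ 2 ν) x ∂ν : ℝ) : ℂ) =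
      (2 * Real.pi : ℂ)⁻¹ * ∫ u, fourierL2 b u * (charFun (ν.restrict s) (-u) - ν.real s) := by
    have h1 : ((∫ x in s, (hb2.toLp : Lp ℝ 2 ν) x ∂ν : ℝ) : ℂ) =
        ∫ x in s, (1 : ℂ) * fourierInv (fourierL2 b) x ∂ν := by
      rw [← integral_complex_ofReal]
      refine integral_congr_ae (ae_restrict_of_ae ?_)
      filter_upwards [hb2.coeFn_toLp, hae] with x hx1 hx2
      rw [hx1, hx2, ofReal_contVersion hb, one_mul]
    -- This integral is `b(0) ν(s)`; the condition `b(0) = 0` absorbs the `-1` in `e_u - 1`.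
    have h2 : (2 * Real.pi : ℂ)⁻¹ * ∫ u, fourierL2 b u * (ν.real s : ℂ) = 0 := by
      rw [integral_mul_const, ← mul_assoc]
      have := ofReal_contVersion hb 0
      rw [hb0, fourierInv] at this
      simp only [Complex.ofReal_zero, mul_zero, neg_zero, Complex.exp_zero, one_mul] at this
      rw [← this, zero_mul]
    have hint : Integrable (fun u => fourierL2 b u * charFun (ν.restrict s) (-u)) volume :=
      hhb.mul_bdd (c := (ν.restrict s).real Set.univ)
        (measurable_charFun.comp measurable_neg).aestronglyMeasurable
        (by filter_upwards with u; exact norm_charFun_le _)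
    rw [h1, integral_mul_fourierInv (integrable_const _) hhb]
    simp only [one_mul, ← charFun_eq_integral_exp, mul_sub]
    rw [integral_sub hint (hhb.mul_const _), mul_sub, h2, sub_zero]
  exact hL.trans hR.symm

/-! ### Density of `G` -/

/-- The classes in `L²₀(P)` of smooth functions with compact support. -/
def testSubmodule (P : Measure ℝ) [IsProbabilityMeasure P] : Submodule ℝ (L20 P) where
  carrier := {q | ∃ g : ℝ → ℝ, ContDiff ℝ (⊤ : ℕ∞) g ∧ HasCompactSupport g ∧ (q : Lp ℝ 2 P) =ᵐ[P] g}
  zero_mem' := ⟨0, contDiff_const, HasCompactSupport.zero, Lp.coeFn_zero _ _ _⟩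
  add_mem' := by
    rintro p q ⟨f, hf, hfc, hpf⟩ ⟨g, hg, hgc, hqg⟩
    exact ⟨f + g, hf.add hg, hfc.add hgc, (Lp.coeFn_add _ _).trans (hpf.add hqg)⟩
  smul_mem' := by
    rintro a p ⟨f, hf, hfc, hpf⟩
    exact ⟨a • f, hf.const_smul a, hfc.smul_left (f := fun _ => a),
      (Lp.coeFn_smul _ _).trans (hpf.const_smul a)⟩

/-- Orthogonality to mean-zero test functions forces `h` to be constant, and `h` itself has mean
zero. -/
theorem orthogonal_testSubmodule (P : Measure ℝ) [IsProbabilityMeasure P] :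
    (testSubmodule P)ᗮ = ⊥ := by
  rw [Submodule.eq_bot_iff]
  intro h hh
  have hint : Integrable (h : Lp ℝ 2 P) P := (Lp.memLp _).integrable (by norm_num)
  have hgi : ∀ {g : ℝ → ℝ}, ContDiff ℝ (⊤ : ℕ∞) g → HasCompactSupport g → Integrable g P :=
    fun hg hgc => hg.continuous.integrable_of_hasCompactSupport hgc
  have hghi : ∀ {g : ℝ → ℝ}, ContDiff ℝ (⊤ : ℕ∞) g → HasCompactSupport g →
      Integrable (fun x => g x * (h : Lp ℝ 2 P) x) P := fun hg hgc =>
    (hg.continuous.memLp_of_hasCompactSupport (p := 2) hgc).integrable_mul (Lp.memLp _)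
  have horth : ∀ g : ℝ → ℝ, ContDiff ℝ (⊤ : ℕ∞) g → HasCompactSupport g → ∫ x, g x ∂P = 0 →
      ∫ x, g x * (h : Lp ℝ 2 P) x ∂P = 0 := fun g hg hgc hg0 => by
    have hm : MemLp g 2 P := hg.continuous.memLp_of_hasCompactSupport hgc
    have hq : hm.toLp ∈ L20 P := (integral_congr_ae hm.coeFn_toLp).trans hg0
    have := (Submodule.mem_orthogonal _ _).mp hh ⟨hm.toLp, hq⟩ ⟨g, hg, hgc, hm.coeFn_toLp⟩
    rw [Submodule.coe_inner, L2.inner_def] at this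
    rw [← this]
    refine integral_congr_ae ?_
    filter_upwards [hm.coeFn_toLp] with x hx
    rw [hx, RCLike.inner_apply, conj_trivial, mul_comm]
  obtain ⟨f, hf, hfc, hf0⟩ : ∃ f : ℝ → ℝ, ContDiff ℝ (⊤ : ℕ∞) f ∧ HasCompactSupport f ∧
      ∫ x, f x ∂P ≠ 0 := by
    by_contra! hcon
    have := ae_eq_zero_of_integral_contDiff_smul_eq_zero
      (integrable_const (1 : ℝ) (μ := P)).locallyIntegrable fun g hg hgc => by
        simpa using hcon g hg hgc
    obtain ⟨x, hx⟩ := this.exists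
    exact one_ne_zero hx
  set κ : ℝ := (∫ x, f x * (h : Lp ℝ 2 P) x ∂P) / ∫ x, f x ∂P with hκ
  have hconst : ∀ᵐ x ∂P, (h : Lp ℝ 2 P) x - κ = 0 := by
    refine ae_eq_zero_of_integral_contDiff_smul_eq_zero
      (hint.sub (integrable_const κ)).locallyIntegrable fun g hg hgc => ?_
    -- An arbitrary test function `g` is corrected to mean zero by a multiple of the fixed `f` with
    -- nonzero mean.
    set r : ℝ := (∫ x, g x ∂P) / ∫ x, f x ∂P with hr
    have h1 : ∫ x, (g x - r * f x) ∂P = 0 := by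
      rw [integral_sub (hgi hg hgc) ((hgi hf hfc).const_mul r), integral_const_mul, hr,
        div_mul_cancel₀ _ hf0, sub_self]
    have h2 := horth (fun x => g x - r * f x) (hg.sub (contDiff_const.mul hf))
      (hgc.sub hfc.mul_left) h1
    have h3 : ∫ x, (g x - r * f x) * (h : Lp ℝ 2 P) x ∂P = ∫ x, g x * (h : Lp ℝ 2 P) x ∂P -
        r * ∫ x, f x * (h : Lp ℝ 2 P) x ∂P := by
      rw [← integral_const_mul, ← integral_sub (hghi hg hgc) ((hghi hf hfc).const_mul r)]
      congr 1 with x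
      ring
    simp only [smul_eq_mul, mul_sub]
    rw [integral_sub (hghi hg hgc) ((hgi hg hgc).mul_const κ), integral_mul_const, ← h2, h3, hκ, hr]
    ring
  have hae : (h : Lp ℝ 2 P) =ᵐ[P] fun _ => κ := by
    filter_upwards [hconst] with x hx
    exact sub_eq_zero.mp hx
  have hκ0 : κ = 0 := by
    have h1 : ∫ x, (h : Lp ℝ 2 P) x ∂P = 0 := h.2
    rw [integral_congr_ae hae] at h1
    simpa using h1
  refine Subtype.ext ((Lp.eq_zero_iff_ae_eq_zero).mpr ?_)
  rw [hκ0] at hae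
  exact hae

theorem denseRange_toL20 {P : Measure ℝ} [IsProbabilityMeasure P] (hP : P ≪ volume) :
    DenseRange (toL20 : setG P → L20 P) := by
  have h := Submodule.topologicalClosure_eq_top_iff.mpr (orthogonal_testSubmodule P)
  have hd : Dense (testSubmodule P : Set (L20 P)) := by
    rw [dense_iff_closure_eq, ← Submodule.topologicalClosure_coe, h, Submodule.top_coe]
  refine hd.mono ?_
  rintro q ⟨g, hg, hgc, hqg⟩
  obtain ⟨f, hf, hfg⟩ := exists_mem_sobolevInfty_ae_eq hg hgc
  have hfq : f =ᵐ[P] (q : Lp ℝ 2 P) := (hP.ae_eq hfg).trans hqg.symm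
  have hfG : f ∈ setG P := (mem_setG_iff hP).mpr ⟨hf, (integral_congr_ae hfq).trans q.2⟩
  exact ⟨⟨f, hfG⟩, Subtype.ext (Lp.ext (hfG.2.1.coeFn_toLp.trans hfq))⟩

end LevyScore

end

/-! ### The main theorem -/

theorem mainTheorem7 {Ω : Type*} [MeasurableSpace Ω] (μ : Measure Ω)
    [IsProbabilityMeasure μ] (L : ℝ≥0 → Ω → ℝ) (γ : ℝ)
    (ν : Measure ℝ)
    (hL : LevyScore.IsFiniteVariationLevyProcess μ L γ ν)
    (Δ : ℝ≥0) (hΔ : 0 < Δ)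
    (P : Measure ℝ) [IsProbabilityMeasure P] (hP : μ.map (L Δ) = P)
    (hν_inf : ν Set.univ = ∞) (hν_ac : ν ≪ volume)
    (β : ℝ) (hβ : 0 < β) (c : ℝ) (hc : 0 < c)
    (hφ : ∀ u : ℝ, c * (1 + |u|) ^ (-β) ≤ ‖LevyScore.levyCharFun Δ γ ν u‖) :
    ∃ A : Lp ℝ 2 ν →L[ℝ] LevyScore.L20 P,
      -- `A` is the score operator, and it is the only one
      LevyScore.IsScoreOperator Δ ν P A ∧
      (∀ A' : Lp ℝ 2 ν →L[ℝ] LevyScore.L20 P, LevyScore.IsScoreOperator Δ ν P A' → A' = A) ∧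
      ∃ T : LevyScore.setG P ≃ LevyScore.setH ν,
        -- (i) the adjoint acts on `G` as the bijection `g ↦ Δ (P(-·) ∗ g)` onto `H`
        (∀ g : LevyScore.setG P,
          (∀ᵐ x ∂volume, Integrable (fun y => (g : Lp ℝ 2 volume) (x + y)) P) ∧
          ((T g : Lp ℝ 2 volume) : ℝ → ℝ) =ᵐ[volume]
            (fun x => (Δ : ℝ) * LevyScore.reflConv P (g : Lp ℝ 2 volume) x) ∧
          (ContinuousLinearMap.adjoint A (LevyScore.toL20 g) : ℝ → ℝ) =ᵐ[ν]
            ((T g : Lp ℝ 2 volume) : ℝ → ℝ)) ∧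
        -- with inverse `b ↦ Δ⁻¹ F⁻¹[F b / φ(-·)]`
        (∀ b : LevyScore.setH ν,
          Integrable (fun u => LevyScore.fourierL2 b u / LevyScore.levyCharFun Δ γ ν (-u)) volume ∧
          (fun x => (((T.symm b : Lp ℝ 2 volume) x : ℝ) : ℂ)) =ᵐ[volume]
            (fun x => ((Δ : ℝ) : ℂ)⁻¹ * LevyScore.fourierInv
              (fun u => LevyScore.fourierL2 b u / LevyScore.levyCharFun Δ γ ν (-u)) x)) ∧
        -- (ii) `G` is dense and the adjoint is the unique continuous extension from `G`
        DenseRange (LevyScore.toL20 : LevyScore.setG P → LevyScore.L20 P) ∧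
        Continuous (ContinuousLinearMap.adjoint A) ∧
        (∀ B : LevyScore.L20 P → Lp ℝ 2 ν, Continuous B →
          (∀ g : LevyScore.setG P,
            (B (LevyScore.toL20 g) : ℝ → ℝ) =ᵐ[ν] ((T g : Lp ℝ 2 volume) : ℝ → ℝ)) →
          B = ContinuousLinearMap.adjoint A) := by
  have hν := hL.jumpMeasure
  have hφP : ∀ u, charFun P u = LevyScore.levyCharFun Δ γ ν u := fun u => by
    rw [← hP]
    exact hL.charFun_eq Δ u
  have hφ' : ∀ u : ℝ, c * (1 + |u|) ^ (-β) ≤ ‖charFun P u‖ := fun u => by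
    rw [hφP]
    exact hφ u
  have hΔ' : 0 < (Δ : ℝ) := hΔ
  have hσ := hν.sigmaFinite
  obtain ⟨A, hA⟩ := LevyScore.exists_hasScoreTransform hΔ' hν hφP
  have hAs := hA.isScoreOperator
  have hPac := hAs.absolutelyContinuous hΔ' hν hν_inf hν_ac
  obtain ⟨T, hT⟩ := LevyScore.exists_equiv hPac hν hν_ac hΔ' hβ hc hφ'
  have hadj : ∀ g : LevyScore.setG P, (ContinuousLinearMap.adjoint A (LevyScore.toL20 g) : ℝ → ℝ)
      =ᵐ[ν] ((T g : Lp ℝ 2 volume) : ℝ → ℝ) := fun g =>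
    LevyScore.adjoint_toL20_ae_eq hA hPac hν hν_ac g (T g) (hT g)
  have hdense := LevyScore.denseRange_toL20 hPac
  refine ⟨A, hAs, fun A' hA' => hAs.unique hA', T, fun g => ⟨?_, ?_, hadj g⟩, fun b => ?_, hdense,
    (ContinuousLinearMap.adjoint A).continuous, fun B hB hBT => ?_⟩
  · filter_upwards with x
    exact LevyScore.integrable_shift hPac g.2.1 x
  · filter_upwards [LevyScore.ae_eq_contVersion (T g).2.1] with x hx
    rw [hx, LevyScore.contVersion_eq_reflConv hPac g.2.1 (T g).2.1 (hT g)]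
  · have hg := LevyScore.integrable_fourierL2 (T.symm b).2.1
    -- The quotient is `Δ` times the transform of `T.symm b ∈ H^∞`, whence both its integrability
    -- and the inversion formula.
    have hquot : (fun u => LevyScore.fourierL2 b u / LevyScore.levyCharFun Δ γ ν (-u)) =ᵐ[volume]
        fun u => ((Δ : ℝ) : ℂ) * LevyScore.fourierL2 (T.symm b) u := by
      have h := hT (T.symm b)
      rw [Equiv.apply_symm_apply] at h
      filter_upwards [h] with u hu
      rw [hu, hφP, mul_right_comm]
      exact mul_div_cancel_right₀ _ (Complex.exp_ne_zero _)
    refine ⟨(hg.const_mul _).congr hquot.symm, ?_⟩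
    filter_upwards [LevyScore.ae_eq_fourierInv_fourierL2 hg] with x hx
    rw [hx, LevyScore.fourierInv_congr_ae hquot, LevyScore.fourierInv_const_mul,
      inv_mul_cancel_left₀ (Complex.ofReal_ne_zero.mpr hΔ'.ne')]
  · refine hdense.equalizer hB (ContinuousLinearMap.adjoint A).continuous (funext fun g => ?_)
    exact Lp.ext ((hBT g).trans (hadj g).symm)
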